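/- Let $\Pi=\{z\in\mathbb C:\operatorname{Im} z>0\}$. For an analytic $f:\Pi\to\overline{\Pi}$ (closed upper half plane, without $\infty$), the Nevanlinna measure $\mu_f$ is the locally finite positive Borel measure on $\mathbb R$ which is the weak limit (against continuous compactly supported functions) of the measures $\operatorname{Im} f(x+iy)\,dx$ as $y\to0^+$. For a monotone increasing $\gamma:[0,\infty)\to[0,\infty)$ with $\gamma(t)=O(t^2)$ as $t\to0$ and $\tau\in\mathbb R$, the function $f$ is called $\gamma$-regular at $\tau$ if there is $C>0$ such that $1/\gamma(C|t-\tau|)$ (with $1/0=+\infty$) is $\mu_f$-integrable on a neighbourhood of $\tau$. A function $\lambda:[0,\infty)\to[0,\infty)$ with $\lambda(t)=o(t)$ as $t\to0$ is called a $\gamma$-augury if there is $C>0$ such that $t\,\lambda(Ct)/\gamma(t)^2$ is integrable on $[0,1)$ with respect to the Lebesgue–Stieltjes measure $d\gamma$. **Theorem.** Let $\gamma:[0,\infty)\to[0,\infty)$ be monotone increasing with $\gamma(t)=O(t^2)$ as $t\to 0$, and suppose that $\gamma$ is itself a $\gamma$-augury. Let $\tau\in\mathbb R$ and let $f:\Pi\to\overline{\Pi}$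 be analytic with a finite nontangential limit $f(\tau)\in\mathbb C$ at $\tau$. 1. Let $U$ be a neighbourhood of $f(\tau)$ and let $g:\Pi\cup U\to\mathbb C$ be an analytic function that is not constant on $\Pi$, with $g(\Pi)\subseteq\overline{\Pi}$ and $g$ real-valued on $\mathbb R\cap U$. Then $f$ is $\gamma$-regular at $\tau$ if and only if $g\circ f$ is $\gamma$-regular at $\tau$. 2. In particular, for every $\alpha\in\mathbb R$ with $1+\alpha f(\tau)\neq0$, $f$ is $\gamma$-regular at $\tau$ if and only if $\dfrac{f}{1+\alpha f}$ is $\gamma$-regular at $\tau$. -/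

import Mathlib

open Set Filter Topology MeasureTheory
open scoped NNReal ENNReal

noncomputable section

/-- The open upper half plane `Π`, as a subset of `ℂ`. -/
def upperHalf : Set ℂ := {z | 0 < z.im}

/-- The closed upper half plane, as a subset of `ℂ`. -/
def closedUpperHalf : Set ℂ := {z | 0 ≤ z.im}

/-- `f` restricts to an analytic map from the open upper half plane to the closed one.
The values of `f` outside the open upper half plane play no role. -/
def IsPick (f : ℂ → ℂ) : Prop :=
  AnalyticOnNhd ℂ f upperHalf ∧ MapsTo f upperHalf closedUpperHalf

/-- The classical Stolz region of `Π` at the boundary point `τ ∈ ℝ`, with aperture `M`. -/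
def stolzRegion (τ M : ℝ) : Set ℂ := {z | z ∈ upperHalf ∧ M * dist z (τ : ℂ) ≤ z.im}

/-- `f` has the (finite) nontangential limit `w` at `τ`. -/
def HasNontangentialLimit (f : ℂ → ℂ) (τ : ℝ) (w : ℂ) : Prop :=
  ∀ M : ℝ, 0 < M → Tendsto f (𝓝[stolzRegion τ M] (τ : ℂ)) (𝓝 w)

/-- `μ` is the Nevanlinna measure of `f`: a locally finite Borel measure on `ℝ` which is the weak
limit, tested against continuous functions of compact support, of the measures
`Im f(x + iy) dx` as `y → 0+`. (There is at most one such `μ`.) -/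
def IsNevanlinnaMeasure (f : ℂ → ℂ) (μ : Measure ℝ) : Prop :=
  IsLocallyFiniteMeasure μ ∧
    ∀ φ : ℝ → ℝ, Continuous φ → HasCompactSupport φ →
      Tendsto (fun y : ℝ => ∫ x : ℝ, φ x * (f (x + y * Complex.I)).im) (𝓝[>] 0)
        (𝓝 (∫ x, φ x ∂μ))

/-- `f` is `γ`-regular at `τ`: for some `C > 0` the function `t ↦ 1 / γ(C|t - τ|)`, which is `∞`
where `γ` vanishes, is integrable against the Nevanlinna measure near `τ`. -/
def IsRegularAt (γ : ℝ≥0 → ℝ≥0) (f : ℂ → ℂ) (τ : ℝ) : Prop :=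
  ∃ μ : Measure ℝ, IsNevanlinnaMeasure f μ ∧
    ∃ C : ℝ≥0, 0 < C ∧ ∃ N ∈ 𝓝 τ,
      ∫⁻ t in N, (γ (C * nndist t τ) : ℝ≥0∞)⁻¹ ∂μ < ∞

/-- A monotone `γ : [0, ∞) → [0, ∞)`, extended to `ℝ` by the constant `γ 0` on the left. -/
def extendLeft (γ : ℝ≥0 → ℝ≥0) (t : ℝ) : ℝ := γ t.toNNReal

theorem extendLeft_monotone {γ : ℝ≥0 → ℝ≥0} (hγ : Monotone γ) : Monotone (extendLeft γ) :=
  fun _ _ h => NNReal.coe_le_coe.2 (hγ (Real.toNNReal_le_toNNReal h))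

/-- The distributional derivative `dγ` of a monotone `γ`: its Lebesgue–Stieltjes measure. -/
def derivMeasure (γ : ℝ≥0 → ℝ≥0) (hγ : Monotone γ) : Measure ℝ :=
  (extendLeft_monotone hγ).stieltjesFunction.measure

/-- `l` is a `γ`-augury: `l(t) = o(t)` as `t → 0`, and for some `C > 0` the function
`t l(Ct) / γ(t)²` is integrable on `[0, 1)` with respect to `dγ`. -/
def IsAugury (γ : ℝ≥0 → ℝ≥0) (hγ : Monotone γ) (l : ℝ≥0 → ℝ≥0) : Prop :=
  (fun t => (l t : ℝ)) =o[𝓝[>] (0 : ℝ≥0)] (fun t => (t : ℝ)) ∧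
    ∃ C : ℝ≥0, 0 < C ∧
      AEMeasurable
        (fun t : ℝ => (t.toNNReal * l (C * t.toNNReal) : ℝ≥0∞) / (γ t.toNNReal : ℝ≥0∞) ^ 2)
        ((derivMeasure γ hγ).restrict (Ico 0 1)) ∧
      ∫⁻ t in Ico (0 : ℝ) 1,
        (t.toNNReal * l (C * t.toNNReal) : ℝ≥0∞) / (γ t.toNNReal : ℝ≥0∞) ^ 2
          ∂(derivMeasure γ hγ) < ∞

end

/-! Regularity at `τ` forces `f` to converge to `f(τ)` not only in cones but in the much wider
region `y ≥ γ(2C|x - τ|)`, and comparing imaginary parts in such a region is enough to pass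
regularity from one function to another.

Convergence (`exists_forall_norm_sub_lt_of_regular`): by Schwarz–Pick, `|f'|` is at most `2 Im f /
y`, and the Poisson representation bounds `Im f(x + iy)` by `O(y) + μ(B)/y` with `B` the ball of
radius `|x - τ|/2` about `x`. Integrating down from the cone costs `O(|x - τ|) + μ(B)/y`, and
regularity gives `μ(B) = o(γ(2C|x - τ|))`.

Transfer (`exists_regular_of_im_le`): suppose `Im h ≤ K Im f` in such a region. Integrating at one
height `y` over `|x - τ| ~ r` bounds the `ν`-mass of a dyadic shell by the `μ`-mass of an enlarged
shell plus `r y`. With `y` decreasing to `γ(Dr)`, dividing by `γ(Dr)` and summing over dyadic `r`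
gives the integrability of `1/γ(D|t - τ|)` against `ν`.

For `g`: since `g` is real on the real line near `f(τ)`, it is Lipschitz there with `Im g(ζ) ≤ L Im
ζ`, which settles one direction. Conversely, the Poisson representation of `g` yields `Im g(ζ) ≥ k
Im ζ` on bounded sets. To use it, `f` must stay bounded in the region where `g ∘ f` is known to
converge; a small circle around `f(τ)` on which `g ≠ g(f(τ))` acts as a barrier
(`exists_forall_norm_sub_lt_of_comp`). -/

/-! ### Herglotz representation in the disc -/

theorem continuous_poissonKernel_circleMap {w : ℂ} (hw : w ∈ Metric.ball (0 : ℂ) 1) :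
    Continuous (fun θ => poissonKernel 0 w (circleMap 0 1 θ)) := by
  simp only [poissonKernel_def]
  refine Continuous.div (by fun_prop) (by fun_prop) fun θ => ?_
  have : circleMap 0 1 θ - w ≠ 0 := sub_ne_zero.2 (circleMap_ne_mem_ball hw θ)
  simpa using this

theorem exists_norm_poissonKernel_circleMap_le {w : ℂ} (hw : w ∈ Metric.ball (0 : ℂ) 1) :
    ∃ B, ∀ θ : ℝ, ‖poissonKernel 0 w (circleMap 0 1 θ)‖ ≤ B := by
  have hw' := mem_ball_zero_iff.1 hw
  refine ⟨1 / (1 - ‖w‖) ^ 2, fun θ => ?_⟩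
  have h1 : 1 - ‖w‖ ≤ ‖circleMap 0 1 θ - w‖ := by
    have := norm_sub_norm_le (circleMap 0 1 θ) w
    simpa using this
  have h2 : 0 ≤ 1 - ‖w‖ ^ 2 := by nlinarith [norm_nonneg w]
  simp only [poissonKernel_def, sub_zero, norm_circleMap_zero, abs_one, one_pow]
  rw [Real.norm_of_nonneg (by positivity)]
  have h3 : 0 < 1 - ‖w‖ := by linarith
  gcongr
  nlinarith [norm_nonneg w]

/-- The Poisson formula for the dilates `F(r z)`, `r < 1`, produces measures on `[0, 2π]` of
constant mass `Im F(0)`. They lie in a weakly compact set, and a limit as `r → 1` represents `F`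
itself. -/
theorem exists_finiteMeasure_im_eq_integral_poissonKernel {F : ℂ → ℂ}
    (hF : DifferentiableOn ℂ F (Metric.ball 0 1))
    (hpos : ∀ w ∈ Metric.ball (0 : ℂ) 1, 0 ≤ (F w).im) :
    ∃ ν : FiniteMeasure ℝ, ∀ w ∈ Metric.ball (0 : ℂ) 1,
      (F w).im = ∫ θ, poissonKernel 0 w (circleMap 0 1 θ) ∂(ν : Measure ℝ) := by
  set r : ℕ → ℝ := fun n => 1 - 1 / ((n : ℝ) + 1) with hr
  have hr0 : ∀ n, 0 ≤ r n := fun n => by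
    have : 1 / ((n : ℝ) + 1) ≤ 1 := by
      rw [div_le_one (by positivity)]; linarith [n.cast_nonneg (α := ℝ)]
    simp only [hr]; linarith
  have hr1 : ∀ n, r n < 1 := fun n => by
    have : 0 < 1 / ((n : ℝ) + 1) := by positivity
    simp only [hr]; linarith
  have hrlim : Tendsto r atTop (𝓝 1) := by
    simpa [hr] using (tendsto_const_nhds (x := (1 : ℝ))).sub tendsto_one_div_add_atTop_nhds_zero_nat
  have hmaps : ∀ n, MapsTo (fun z : ℂ => (r n : ℂ) * z) (Metric.closedBall 0 1)
      (Metric.ball 0 1) := fun n z hz => by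
    simp only [mem_closedBall_zero_iff, mem_ball_zero_iff, norm_mul, Complex.norm_real,
      Real.norm_of_nonneg (hr0 n)] at hz ⊢
    nlinarith [hr0 n, hr1 n, norm_nonneg z]
  have hdiff : ∀ n, DiffContOnCl ℂ (fun z => F (r n * z)) (Metric.ball 0 1) := fun n => by
    have h1 : ContinuousOn (fun z => F (r n * z)) (Metric.closedBall 0 1) :=
      hF.continuousOn.comp (by fun_prop) (hmaps n)
    refine ⟨hF.comp (by fun_prop) ((hmaps n).mono_left Metric.ball_subset_closedBall), ?_⟩
    rwa [closure_ball _ one_ne_zero]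
  have hcirc : ∀ θ : ℝ, circleMap 0 1 θ ∈ Metric.closedBall (0 : ℂ) 1 := fun θ => by simp
  set u : ℕ → ℝ → ℝ := fun n θ => (F (r n * circleMap 0 1 θ)).im with hu
  have hucont : ∀ n, Continuous (u n) := fun n => by
    have : Continuous (fun θ => F (r n * circleMap 0 1 θ)) :=
      hF.continuousOn.comp_continuous (by fun_prop) (fun θ => hmaps n (hcirc θ))
    exact Complex.continuous_im.comp this
  have hu0 : ∀ n θ, 0 ≤ u n θ := fun n θ => hpos _ (hmaps n (hcirc θ))
  have hker : ∀ w ∈ Metric.ball (0 : ℂ) 1,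
      Continuous (fun θ => poissonKernel 0 w (circleMap 0 1 θ)) := fun w hw =>
    continuous_poissonKernel_circleMap hw
  have hint : ∀ n, ∀ w ∈ Metric.ball (0 : ℂ) 1, (F (r n * w)).im =
      ∫ θ in Ioc 0 (2 * Real.pi),
        poissonKernel 0 w (circleMap 0 1 θ) * ((2 * Real.pi)⁻¹ * u n θ) := fun n w hw => by
    have h1 := (hdiff n).circleAverage_poissonKernel_smul hw
    rw [← h1, Real.circleAverage_def, intervalIntegral.integral_of_le (by positivity)]
    have hFc : Continuous (fun θ => F (r n * circleMap 0 1 θ)) :=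
      hF.continuousOn.comp_continuous (by fun_prop) (fun θ => hmaps n (hcirc θ))
    have hi : Integrable (fun θ => (poissonKernel 0 w • fun z => F (r n * z)) (circleMap 0 1 θ))
        (volume.restrict (Ioc 0 (2 * Real.pi))) := by
      have : Continuous
          (fun θ => (poissonKernel 0 w • fun z => F (r n * z)) (circleMap 0 1 θ)) :=
        (hker w hw).smul hFc
      exact (this.integrableOn_Icc (a := 0) (b := 2 * Real.pi)).mono_set Ioc_subset_Icc_self
    have h2 := Complex.imCLM.integral_comp_comm hi
    rw [Complex.smul_im, ← Complex.imCLM_apply, ← h2, smul_eq_mul, ← integral_const_mul]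
    congr 1
    ext θ
    simp [hu]
    ring
  set m : ℕ → Measure ℝ := fun n => (volume.restrict (Ioc 0 (2 * Real.pi))).withDensity
    (fun θ => ENNReal.ofReal ((2 * Real.pi)⁻¹ * u n θ)) with hm
  have hd0 : ∀ n θ, 0 ≤ (2 * Real.pi)⁻¹ * u n θ := fun n θ =>
    mul_nonneg (by positivity) (hu0 n θ)
  have hdi : ∀ n, Integrable (fun θ => (2 * Real.pi)⁻¹ * u n θ)
      (volume.restrict (Ioc 0 (2 * Real.pi))) := fun n =>
    (((continuous_const.mul (hucont n)).integrableOn_Icc (a := 0) (b := 2 * Real.pi))).mono_set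
      Ioc_subset_Icc_self
  have hmass : ∀ n, m n univ = ENNReal.ofReal (F 0).im := fun n => by
    have := hint n 0 (by simp)
    simp only [mul_zero] at this
    rw [hm, withDensity_apply _ MeasurableSet.univ, Measure.restrict_univ,
      ← ofReal_integral_eq_lintegral_ofReal (hdi n) (ae_of_all _ (hd0 n)), this]
    congr 1
    refine integral_congr_ae (ae_of_all _ fun θ => ?_)
    simp [poissonKernel_def]
  have hfin : ∀ n, IsFiniteMeasure (m n) := fun n => ⟨by rw [hmass]; exact ENNReal.ofReal_lt_top⟩
  set M : ℕ → FiniteMeasure ℝ := fun n => ⟨m n, hfin n⟩ with hM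
  have hK : IsCompact {μ : FiniteMeasure ℝ | μ.mass ≤ (F 0).im.toNNReal ∧
      μ (Icc 0 (2 * Real.pi))ᶜ = 0} :=
    isCompact_setOfPred_finiteMeasure_le_of_isCompact _ isCompact_Icc
  have hMK : ∀ n, M n ∈ {μ : FiniteMeasure ℝ | μ.mass ≤ (F 0).im.toNNReal ∧
      μ (Icc 0 (2 * Real.pi))ᶜ = 0} := fun n => by
    constructor
    · rw [← ENNReal.coe_le_coe, FiniteMeasure.ennreal_mass]
      exact (hmass n).le
    · rw [← ENNReal.coe_eq_zero, FiniteMeasure.ennreal_coeFn_eq_coeFn_toMeasure]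
      refine (withDensity_absolutelyContinuous _ _ : m n ≪ _) ?_
      rw [Measure.restrict_apply measurableSet_Icc.compl]
      convert measure_empty (μ := volume)
      ext x; simp only [mem_inter_iff, mem_compl_iff, mem_Icc, mem_Ioc, mem_empty_iff_false]
      grind
  -- Compactness gives a limit along an ultrafilter, so no subsequence is extracted; the values `F(r
  -- w)` converge along `atTop`, hence along it too.
  obtain ⟨ν, -, hν⟩ := hK.ultrafilter_le_nhds ((hyperfilter ℕ).map M)
    (le_principal_iff.2 (Filter.mem_map.2 (univ_mem' hMK)))
  have hν' : Tendsto M (hyperfilter ℕ) (𝓝 ν) := hν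
  have hle : ((hyperfilter ℕ : Ultrafilter ℕ) : Filter ℕ) ≤ atTop := Nat.hyperfilter_le_atTop
  refine ⟨ν, fun w hw => ?_⟩
  obtain ⟨B, hB⟩ := exists_norm_poissonKernel_circleMap_le hw
  have h1 := (FiniteMeasure.tendsto_iff_forall_integral_tendsto.1 hν')
    (BoundedContinuousFunction.ofNormedAddCommGroup _ (hker w hw) B hB)
  have h2 : Tendsto (fun n => (F (r n * w)).im) atTop (𝓝 (F w).im) := by
    have h3 : ContinuousAt F w := hF.continuousOn.continuousAt (Metric.isOpen_ball.mem_nhds hw)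
    have h4 : Tendsto (fun n => (r n : ℂ) * w) atTop (𝓝 w) := by
      have := ((Complex.continuous_ofReal.tendsto 1).comp hrlim).mul_const w
      simpa using this
    exact (Complex.continuous_im.tendsto _).comp (h3.tendsto.comp h4)
  refine tendsto_nhds_unique (h2.mono_left hle) ?_
  refine h1.congr fun n => ?_
  rw [hint n w hw]
  simp only [BoundedContinuousFunction.coe_ofNormedAddCommGroup, hM, FiniteMeasure.toMeasure_mk, hm]
  rw [integral_withDensity_eq_integral_toReal_smul
    (by have := hucont n; fun_prop) (ae_of_all _ fun _ => ENNReal.ofReal_lt_top)]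
  congr 1
  ext θ
  rw [ENNReal.toReal_ofReal (hd0 n θ), smul_eq_mul, mul_comm]

/-! ### Cayley transform to the half plane -/

/-- The Poisson kernel `y / ((t - x)² + y²)` of the upper half plane, without the factor `1 / π`. -/
noncomputable def halfPlaneKernel (x y t : ℝ) : ℝ := y / ((t - x) ^ 2 + y ^ 2)

theorem norm_cayley_lt_one {z : ℂ} (hz : 0 < z.im) : ‖(z - Complex.I) / (z + Complex.I)‖ < 1 := by
  have h0 : z + Complex.I ≠ 0 := fun h => by
    have := congrArg Complex.im h
    simp at this; linarith
  rw [norm_div, div_lt_one (norm_pos_iff.2 h0)]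
  refine lt_of_pow_lt_pow_left₀ 2 (norm_nonneg _) ?_
  rw [← Complex.normSq_eq_norm_sq, ← Complex.normSq_eq_norm_sq, Complex.normSq_apply,
    Complex.normSq_apply]
  simp
  nlinarith

theorem inverse_cayley_im_pos {w : ℂ} (hw : ‖w‖ < 1) :
    0 < (Complex.I * (1 + w) / (1 - w)).im := by
  have h0 : 1 - w ≠ 0 := fun h => by
    rw [← sub_eq_zero.1 h] at hw; simp at hw
  have h1 : 0 < Complex.normSq (1 - w) := Complex.normSq_pos.2 h0
  have h2 : w.re * w.re + w.im * w.im < 1 := by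
    rw [← Complex.normSq_apply, Complex.normSq_eq_norm_sq]
    nlinarith [norm_nonneg w]
  rw [Complex.div_im]
  have : 0 < (1 - w.re * w.re - w.im * w.im) / Complex.normSq (1 - w) :=
    div_pos (by linarith) h1
  convert this using 1
  simp
  ring

theorem inverse_cayley_cayley {z : ℂ} (hz : 0 < z.im) :
    Complex.I * (1 + (z - Complex.I) / (z + Complex.I)) / (1 - (z - Complex.I) / (z + Complex.I))
      = z := by
  have h0 : z + Complex.I ≠ 0 := fun h => by
    have := congrArg Complex.im h
    simp at this; linarith
  have h1 : 1 - (z - Complex.I) / (z + Complex.I) = 2 * Complex.I / (z + Complex.I) := by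
    field_simp; ring
  have h2 : 1 + (z - Complex.I) / (z + Complex.I) = 2 * z / (z + Complex.I) := by
    field_simp; ring
  rw [h1, h2]
  field_simp

/-- Clearing the denominator `z + i` keeps the formula meaningful at `ζ = 1`, the image of `∞`,
where the kernel becomes `Im z`. -/
theorem poissonKernel_cayley {z ζ : ℂ} (hz : 0 < z.im) (hζ : ‖ζ‖ = 1) :
    poissonKernel 0 ((z - Complex.I) / (z + Complex.I)) ζ =
      4 * z.im / Complex.normSq (ζ * (z + Complex.I) - (z - Complex.I)) := by
  have h0 : z + Complex.I ≠ 0 := fun h => by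
    have := congrArg Complex.im h
    simp at this; linarith
  have h1 : ζ - (z - Complex.I) / (z + Complex.I) =
      (ζ * (z + Complex.I) - (z - Complex.I)) / (z + Complex.I) := by
    field_simp
  have h2 : 0 < Complex.normSq (z + Complex.I) := Complex.normSq_pos.2 h0
  have h3 : Complex.normSq (z + Complex.I) - Complex.normSq (z - Complex.I) = 4 * z.im := by
    simp [Complex.normSq_apply]; ring
  rw [poissonKernel_def, sub_zero, sub_zero, hζ, h1, ← Complex.normSq_eq_norm_sq,
    ← Complex.normSq_eq_norm_sq, Complex.normSq_div, Complex.normSq_div, ← h3]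
  field_simp

theorem normSq_cayley_pole_one (z : ℂ) :
    Complex.normSq (1 * (z + Complex.I) - (z - Complex.I)) = 4 := by
  simp [Complex.normSq_apply]; norm_num

/-- The real number `t = -q / (1 - p)` is the boundary point that the Cayley transform sends to `p +
iq`; everything reduces to `(1 + t²)(1 - p) = 2`. -/
theorem cayley_kernel_eq {x y p q : ℝ} (hy : 0 < y) (hpq : p ^ 2 + q ^ 2 = 1) (hp : p ≠ 1) :
    4 * y / ((x * (p - 1) - q * (y + 1)) ^ 2 + (p * (y + 1) + q * x - (y - 1)) ^ 2) =
      (1 + (-q / (1 - p)) ^ 2) * halfPlaneKernel x y (-q / (1 - p)) := by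
  have hp' : 0 < 1 - p := by
    have : p ≤ 1 := by nlinarith
    exact sub_pos.2 (lt_of_le_of_ne this hp)
  set t := -q / (1 - p) with ht
  have hq : q = -t * (1 - p) := by rw [ht]; field_simp
  have h1 : (1 + t ^ 2) * (1 - p) = 2 := by
    have : (1 - p) * ((1 + t ^ 2) * (1 - p) - 2) = 0 := by
      rw [hq] at hpq
      linear_combination hpq
    rcases mul_eq_zero.1 this with h | h <;> linarith
  have hD : 0 < (t - x) ^ 2 + y ^ 2 := by positivity
  have h2 : (x * (p - 1) - q * (y + 1)) ^ 2 + (p * (y + 1) + q * x - (y - 1)) ^ 2 =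
      2 * (1 - p) * ((t - x) ^ 2 + y ^ 2) := by
    have e1 : x * (p - 1) - q * (y + 1) = (1 - p) * (t * (y + 1) - x) := by rw [hq]; ring
    have e2 : p * (y + 1) + q * x - (y - 1) = (1 - p) * (t ^ 2 - y - t * x) := by
      rw [hq]; linear_combination -h1
    rw [e1, e2]
    linear_combination (1 - p) * ((t - x) ^ 2 + y ^ 2) * h1
  rw [h2, halfPlaneKernel, div_eq_iff (by positivity)]
  field_simp
  linear_combination -2 * h1

theorem halfPlaneKernel_pos {x y t : ℝ} (hy : 0 < y) : 0 < halfPlaneKernel x y t := by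
  rw [halfPlaneKernel]; positivity

theorem continuous_halfPlaneKernel (x : ℝ) {y : ℝ} (hy : 0 < y) :
    Continuous (halfPlaneKernel x y) := by
  unfold halfPlaneKernel
  exact Continuous.div (by fun_prop) (by fun_prop) fun t => by positivity

/-- The mass of the disc measure over the boundary point `1` becomes the linear term `a y`; the rest
is pushed forward to the line. -/
theorem IsPick.exists_im_eq_integral {f : ℂ → ℂ} (hf : IsPick f) :
    ∃ a : ℝ, 0 ≤ a ∧ ∃ σ : Measure ℝ, IsFiniteMeasure σ ∧ ∀ x y : ℝ, 0 < y →
      (f (x + y * Complex.I)).im = a * y + ∫ t, (1 + t ^ 2) * halfPlaneKernel x y t ∂σ := by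
  set F : ℂ → ℂ := fun w => f (Complex.I * (1 + w) / (1 - w)) with hF
  have hFd : DifferentiableOn ℂ F (Metric.ball 0 1) := by
    refine hf.1.differentiableOn.comp (t := upperHalf) ?_ fun w hw =>
      inverse_cayley_im_pos (mem_ball_zero_iff.1 hw)
    refine DifferentiableOn.div (by fun_prop) (by fun_prop) fun w hw h => ?_
    rw [← sub_eq_zero.1 h] at hw; simp at hw
  obtain ⟨ν, hν⟩ := exists_finiteMeasure_im_eq_integral_poissonKernel hFd fun w hw =>
    hf.2 (inverse_cayley_im_pos (mem_ball_zero_iff.1 hw))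
  set S : Set ℝ := {θ | Real.cos θ = 1} with hS
  have hSm : MeasurableSet S := (isClosed_eq Real.continuous_cos continuous_const).measurableSet
  set T : ℝ → ℝ := fun θ => -Real.sin θ / (1 - Real.cos θ) with hT
  have hTm : Measurable T := by fun_prop
  refine ⟨(ν : Measure ℝ).real S, measureReal_nonneg, ((ν : Measure ℝ).restrict Sᶜ).map T,
    Measure.isFiniteMeasure_map _ _, fun x y hy => ?_⟩
  set z : ℂ := x + y * Complex.I with hz
  have hzim : z.im = y := by simp [hz]
  have hzre : z.re = x := by simp [hz]
  have hz0 : 0 < z.im := by rwa [hzim]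
  have h1 := hν _ (mem_ball_zero_iff.2 (norm_cayley_lt_one hz0))
  simp only [hF, inverse_cayley_cayley hz0] at h1
  have hker : ∀ θ : ℝ, poissonKernel 0 ((z - Complex.I) / (z + Complex.I)) (circleMap 0 1 θ) =
      if θ ∈ S then y else (1 + T θ ^ 2) * halfPlaneKernel x y (T θ) := fun θ => by
    rw [poissonKernel_cayley hz0 (by simp)]
    have hcm : circleMap 0 1 θ = ⟨Real.cos θ, Real.sin θ⟩ := by
      apply Complex.ext <;> simp [circleMap, Complex.exp_re, Complex.exp_im]
    split_ifs with h
    · have h' : Real.cos θ = 1 := h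
      have hs : Real.sin θ = 0 := by
        have := Real.sin_sq_add_cos_sq θ
        rw [h'] at this; nlinarith
      have : circleMap 0 1 θ = 1 := by rw [hcm, h', hs]; rfl
      rw [this, normSq_cayley_pole_one, hzim]; ring
    · rw [hT, ← cayley_kernel_eq hy (Real.cos_sq_add_sin_sq θ) h, hcm, Complex.normSq_apply, hzim]
      congr 1
      simp [hzre, hzim]
      ring
  rw [h1]
  simp only [hker]
  have hbd : Integrable (fun θ => if θ ∈ S then y else (1 + T θ ^ 2) * halfPlaneKernel x y (T θ))
      (ν : Measure ℝ) := by
    have hw := mem_ball_zero_iff.2 (norm_cayley_lt_one hz0)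
    obtain ⟨B, hB⟩ := exists_norm_poissonKernel_circleMap_le hw
    refine Integrable.congr ?_ (ae_of_all _ hker)
    exact Integrable.of_bound (continuous_poissonKernel_circleMap hw).aestronglyMeasurable B
      (ae_of_all _ hB)
  rw [← integral_add_compl hSm hbd]
  congr 1
  · rw [setIntegral_congr_fun hSm (g := fun _ => y) (fun θ hθ => by simp [hθ])]
    simp
  · rw [integral_map hTm.aemeasurable
      (by have := (continuous_halfPlaneKernel x hy)
          exact Continuous.aestronglyMeasurable (by fun_prop))]
    exact setIntegral_congr_fun hSm.compl (fun θ hθ => by simp [show θ ∉ S from hθ])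

/-! ### Weak convergence of Poisson integrals -/

/-- The growth of `1 + t²` is absorbed by `(t - x)² · kernel ≤ y`. For `x` in a compact set this
leads to majorants uniform in `t`, which a finite measure integrates. -/
theorem one_add_sq_mul_halfPlaneKernel_le {R x y t : ℝ} (hx : |x| ≤ R) (hy : 0 < y) :
    (1 + t ^ 2) * halfPlaneKernel x y t ≤ 2 * (1 + R ^ 2) * (y + halfPlaneKernel x y t) := by
  have hx2 : x ^ 2 ≤ R ^ 2 := sq_le_sq' (abs_le.1 hx).1 (abs_le.1 hx).2
  have hk : 0 < halfPlaneKernel x y t := halfPlaneKernel_pos hy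
  have hD : 0 < (t - x) ^ 2 + y ^ 2 := by positivity
  have h1 : (t - x) ^ 2 * halfPlaneKernel x y t ≤ y := by
    rw [halfPlaneKernel, ← mul_div_assoc, div_le_iff₀ hD]
    nlinarith [pow_pos hy 2]
  have h2 : 1 + t ^ 2 ≤ 2 * (1 + R ^ 2) * ((t - x) ^ 2 + 1) := by
    nlinarith [sq_nonneg (t - 2 * x), sq_nonneg (R * (t - x)), sq_nonneg (t - x)]
  calc (1 + t ^ 2) * halfPlaneKernel x y t
      ≤ 2 * (1 + R ^ 2) * ((t - x) ^ 2 + 1) * halfPlaneKernel x y t := by gcongr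
    _ = 2 * (1 + R ^ 2) * ((t - x) ^ 2 * halfPlaneKernel x y t + halfPlaneKernel x y t) := by ring
    _ ≤ _ := by gcongr

theorem halfPlaneKernel_le {x y t : ℝ} (hy : 0 < y) : halfPlaneKernel x y t ≤ y⁻¹ := by
  rw [halfPlaneKernel, div_le_iff₀ (by positivity), inv_mul_eq_div, le_div_iff₀ hy]
  nlinarith [sq_nonneg (t - x)]

theorem continuous_halfPlaneKernel_uncurry {y : ℝ} (hy : 0 < y) :
    Continuous (fun p : ℝ × ℝ => halfPlaneKernel p.1 y p.2) := by
  unfold halfPlaneKernel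
  exact Continuous.div (by fun_prop) (by fun_prop) fun t => by positivity

theorem integral_mul_halfPlaneKernel (φ : ℝ → ℝ) {y : ℝ} (hy : 0 < y) (t : ℝ) :
    ∫ x, φ x * halfPlaneKernel x y t = ∫ s, φ (t + y * s) * (1 + s ^ 2)⁻¹ := by
  rw [← integral_add_left_eq_self _ t]
  have h := Measure.integral_comp_mul_left (fun s => φ (t + s) * halfPlaneKernel (t + s) y t) y
  rw [abs_of_pos (inv_pos.2 hy), smul_eq_mul, inv_mul_eq_div, eq_div_iff hy.ne', mul_comm,
    ← integral_const_mul] at h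
  rw [← h]
  congr 1
  ext s
  rw [halfPlaneKernel]
  have : 1 + s ^ 2 ≠ 0 := by positivity
  have h2 : (t - (t + y * s)) ^ 2 + y ^ 2 = y ^ 2 * (1 + s ^ 2) := by ring
  rw [h2]
  field_simp

theorem integral_halfPlaneKernel {y : ℝ} (hy : 0 < y) (t : ℝ) :
    ∫ x, halfPlaneKernel x y t = Real.pi := by
  simpa using integral_mul_halfPlaneKernel (fun _ => 1) hy t

theorem integrable_halfPlaneKernel {y : ℝ} (hy : 0 < y) (t : ℝ) :
    Integrable (fun x => halfPlaneKernel x y t) := by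
  by_contra h
  have := integral_undef h
  rw [integral_halfPlaneKernel hy] at this
  exact Real.pi_ne_zero this

theorem tendsto_integral_mul_halfPlaneKernel {φ : ℝ → ℝ} (hφ : Continuous φ) {M : ℝ}
    (hM : ∀ x, |φ x| ≤ M) (t : ℝ) :
    Tendsto (fun y => ∫ x, φ x * halfPlaneKernel x y t) (𝓝[>] 0) (𝓝 (Real.pi * φ t)) := by
  have h1 : Tendsto (fun y => ∫ s, φ (t + y * s) * (1 + s ^ 2)⁻¹) (𝓝[>] 0)
      (𝓝 (∫ s, φ t * (1 + s ^ 2)⁻¹)) := by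
    refine tendsto_integral_filter_of_dominated_convergence (fun s => M * (1 + s ^ 2)⁻¹)
      (Eventually.of_forall fun y => ?_) (Eventually.of_forall fun y => ae_of_all _ fun s => ?_)
      (integrable_inv_one_add_sq.const_mul M) (ae_of_all _ fun s => ?_)
    · exact Measurable.aestronglyMeasurable (by fun_prop)
    · rw [norm_mul, Real.norm_eq_abs, Real.norm_of_nonneg (by positivity)]
      gcongr
      exact hM _
    · refine Tendsto.mul_const _ ?_
      have : Continuous (fun y => φ (t + y * s)) := by fun_prop
      simpa using (this.tendsto 0).mono_left nhdsWithin_le_nhds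
  rw [integral_const_mul, integral_univ_inv_one_add_sq, mul_comm] at h1
  refine h1.congr' ?_
  filter_upwards [self_mem_nhdsWithin] with y hy
  rw [integral_mul_halfPlaneKernel φ hy]

section Representation

variable {σ : Measure ℝ} [IsFiniteMeasure σ]

theorem integrable_one_add_sq_mul_halfPlaneKernel (x : ℝ) {y : ℝ} (hy : 0 < y) :
    Integrable (fun t => (1 + t ^ 2) * halfPlaneKernel x y t) σ := by
  have := continuous_halfPlaneKernel x hy
  refine Integrable.of_bound (Continuous.aestronglyMeasurable (by fun_prop))
    (2 * (1 + |x| ^ 2) * (y + y⁻¹)) (ae_of_all _ fun t => ?_)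
  have hk : 0 < halfPlaneKernel x y t := halfPlaneKernel_pos hy
  rw [Real.norm_of_nonneg (by positivity)]
  refine (one_add_sq_mul_halfPlaneKernel_le le_rfl hy).trans ?_
  gcongr
  exact halfPlaneKernel_le hy

/-- After Fubini the inner integral is the Poisson mean of `φ`, an approximate identity of total
mass `π`; dominated convergence in `t` uses a constant majorant. -/
theorem tendsto_integral_mul_poisson {φ : ℝ → ℝ} (hφ : Continuous φ)
    (hc : HasCompactSupport φ) :
    Tendsto (fun y => ∫ x, φ x * ∫ t, (1 + t ^ 2) * halfPlaneKernel x y t ∂σ) (𝓝[>] 0)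
      (𝓝 (∫ t, (1 + t ^ 2) * (Real.pi * φ t) ∂σ)) := by
  obtain ⟨M, hM⟩ := hφ.bounded_above_of_compact_support hc
  obtain ⟨R, hR⟩ := hc.isBounded.exists_norm_le
  have hi : Integrable φ := hφ.integrable_of_hasCompactSupport hc
  have hsupp : ∀ x y t : ℝ, 0 < y → |φ x| * ((1 + t ^ 2) * halfPlaneKernel x y t) ≤
      |φ x| * (2 * (1 + R ^ 2) * (y + halfPlaneKernel x y t)) := fun x y t hy => by
    by_cases hx : x ∈ tsupport φ
    · exact mul_le_mul_of_nonneg_left (one_add_sq_mul_halfPlaneKernel_le (hR x hx) hy)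
        (abs_nonneg _)
    · simp [image_eq_zero_of_notMem_tsupport hx]
  have hswap : ∀ y : ℝ, 0 < y → ∫ x, φ x * ∫ t, (1 + t ^ 2) * halfPlaneKernel x y t ∂σ =
      ∫ t, (1 + t ^ 2) * (∫ x, φ x * halfPlaneKernel x y t) ∂σ := fun y hy => by
    have hcont := continuous_halfPlaneKernel_uncurry hy
    have hint : Integrable (Function.uncurry fun x t =>
        φ x * ((1 + t ^ 2) * halfPlaneKernel x y t)) (volume.prod σ) := by
      have hb : Integrable (fun p : ℝ × ℝ => |φ p.1| * (2 * (1 + R ^ 2) * (y + y⁻¹)))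
          (volume.prod σ) := (hi.abs.comp_fst σ).mul_const _
      refine hb.mono (Continuous.aestronglyMeasurable ?_) (ae_of_all _ fun p => ?_)
      · simp only [Function.uncurry_def]
        fun_prop
      · have hk : 0 < halfPlaneKernel p.1 y p.2 := halfPlaneKernel_pos hy
        simp only [Function.uncurry_def]
        rw [norm_mul, Real.norm_eq_abs, Real.norm_of_nonneg (by positivity),
          Real.norm_of_nonneg (by positivity)]
        refine (hsupp _ _ _ hy).trans ?_
        gcongr
        exact halfPlaneKernel_le hy
    simp only [← integral_const_mul]
    rw [integral_integral_swap hint]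
    refine integral_congr_ae (ae_of_all _ fun t => integral_congr_ae (ae_of_all _ fun x => ?_))
    ring
  have hmain : Tendsto (fun y => ∫ t, (1 + t ^ 2) * (∫ x, φ x * halfPlaneKernel x y t) ∂σ) (𝓝[>] 0)
      (𝓝 (∫ t, (1 + t ^ 2) * (Real.pi * φ t) ∂σ)) := by
    refine tendsto_integral_filter_of_dominated_convergence
      (fun _ => 2 * (1 + R ^ 2) * ((∫ x, |φ x|) + M * Real.pi)) ?_ ?_
      (integrable_const _) (ae_of_all _ fun t =>
        (tendsto_integral_mul_halfPlaneKernel hφ hM t).const_mul _)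
    · filter_upwards [self_mem_nhdsWithin] with y hy
      have hcont := continuous_halfPlaneKernel_uncurry (y := y) hy
      refine AEStronglyMeasurable.mul (Continuous.aestronglyMeasurable (by fun_prop)) ?_
      refine StronglyMeasurable.aestronglyMeasurable ?_
      refine StronglyMeasurable.integral_prod_right (f := fun t x => φ x * halfPlaneKernel x y t) ?_
      refine Continuous.stronglyMeasurable ?_
      have := hcont.comp continuous_swap
      simp only [Function.uncurry_def]
      simp only [Function.comp_def, Prod.fst_swap, Prod.snd_swap] at this
      fun_prop
    · filter_upwards [Ioo_mem_nhdsGT (zero_lt_one' ℝ)] with y hy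
      refine ae_of_all _ fun t => ?_
      rw [norm_mul, Real.norm_of_nonneg (by positivity)]
      have hk : ∀ x, 0 < halfPlaneKernel x y t := fun x => halfPlaneKernel_pos hy.1
      have hki := integrable_halfPlaneKernel hy.1 t
      have hpki : Integrable (fun x => |φ x| * halfPlaneKernel x y t) := by
        refine hki.bdd_mul (c := M) (hφ.abs.aestronglyMeasurable) (ae_of_all _ fun x => ?_)
        simpa using hM x
      calc (1 + t ^ 2) * ‖∫ x, φ x * halfPlaneKernel x y t‖
          ≤ (1 + t ^ 2) * ∫ x, |φ x| * halfPlaneKernel x y t := by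
            gcongr
            refine (norm_integral_le_integral_norm _).trans_eq (integral_congr_ae
              (ae_of_all _ fun x => ?_))
            simp [abs_of_pos (hk x)]
        _ = ∫ x, |φ x| * ((1 + t ^ 2) * halfPlaneKernel x y t) := by
            rw [← integral_const_mul]; congr 1; ext x; ring
        _ ≤ ∫ x, 2 * (1 + R ^ 2) * (|φ x| + M * halfPlaneKernel x y t) := by
            refine integral_mono_of_nonneg (ae_of_all _ fun x => ?_)
              ((hi.abs.add (hki.const_mul M)).const_mul _) (ae_of_all _ fun x => ?_)
            · have := hk x
              simp only [Pi.zero_apply]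
              positivity
            · refine (hsupp x y t hy.1).trans ?_
              rw [mul_left_comm]
              have := (hk x).le
              have h3 := hM x
              rw [Real.norm_eq_abs] at h3
              refine mul_le_mul_of_nonneg_left ?_ (by positivity)
              rw [mul_add]
              refine add_le_add ?_ ?_
              · exact mul_le_of_le_one_right (abs_nonneg _) hy.2.le
              · exact mul_le_mul_of_nonneg_right h3 this
        _ = _ := by
            rw [integral_const_mul, integral_add hi.abs (hki.const_mul M), integral_const_mul,
              integral_halfPlaneKernel hy.1]
  refine hmain.congr' ?_
  filter_upwards [self_mem_nhdsWithin] with y hy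
  exact (hswap y hy).symm

end Representation

/-! ### The Nevanlinna measure and its Poisson representation -/

/-- `μ` represents `π • Im f` in the upper half plane as a linear term plus a Poisson integral. -/
def IsPoissonMeasure (f : ℂ → ℂ) (a : ℝ) (μ : Measure ℝ) : Prop :=
  0 ≤ a ∧ ∫⁻ t, ENNReal.ofReal (1 + t ^ 2)⁻¹ ∂μ < ∞ ∧ ∀ x y : ℝ, 0 < y →
    ENNReal.ofReal (Real.pi * (f (x + y * Complex.I)).im) =
      ENNReal.ofReal (a * y) + ∫⁻ t, ENNReal.ofReal (halfPlaneKernel x y t) ∂μ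

theorem IsNevanlinnaMeasure.unique {f : ℂ → ℂ} {μ ν : Measure ℝ} (hμ : IsNevanlinnaMeasure f μ)
    (hν : IsNevanlinnaMeasure f ν) : μ = ν := by
  have := hμ.1
  have := hν.1
  refine Measure.ext_of_integral_eq_on_compactlySupported fun φ => ?_
  exact tendsto_nhds_unique (hμ.2 φ φ.continuous φ.hasCompactSupport)
    (hν.2 φ φ.continuous φ.hasCompactSupport)

theorem IsPick.exists_isNevanlinnaMeasure {f : ℂ → ℂ} (hf : IsPick f) :
    ∃ μ, IsNevanlinnaMeasure f μ ∧ ∃ a, IsPoissonMeasure f a μ := by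
  obtain ⟨a, ha, σ, hσ, hrep⟩ := hf.exists_im_eq_integral
  have hm : Measurable fun t : ℝ => ENNReal.ofReal (Real.pi * (1 + t ^ 2)) := by fun_prop
  -- The factor `π` is the mass of the unnormalised kernel. The linear term of `f` has no share in
  -- the measure, since it vanishes as `y → 0`.
  refine ⟨σ.withDensity fun t => ENNReal.ofReal (Real.pi * (1 + t ^ 2)),
    ⟨IsLocallyFiniteMeasure.withDensity_ofReal (by fun_prop), fun φ hφ hc => ?_⟩,
    Real.pi * a, by positivity, ?_, fun x y hy => ?_⟩
  · have hi : Integrable φ := hφ.integrable_of_hasCompactSupport hc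
    rw [integral_withDensity_eq_integral_toReal_smul hm
      (ae_of_all _ fun _ => ENNReal.ofReal_lt_top)]
    have h1 := tendsto_integral_mul_poisson (σ := σ) hφ hc
    have h2 : Tendsto (fun y : ℝ => a * y * ∫ x, φ x) (𝓝[>] 0) (𝓝 0) := by
      have : Continuous (fun y : ℝ => a * y * ∫ x, φ x) := by fun_prop
      simpa using (this.tendsto 0).mono_left nhdsWithin_le_nhds
    have h3 := h2.add h1
    rw [zero_add] at h3
    have h4 : ∫ t, (ENNReal.ofReal (Real.pi * (1 + t ^ 2))).toReal • φ t ∂σ =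
        ∫ t, (1 + t ^ 2) * (Real.pi * φ t) ∂σ := by
      congr 1
      ext t
      rw [ENNReal.toReal_ofReal (by positivity), smul_eq_mul]
      ring
    rw [h4]
    refine h3.congr' ?_
    filter_upwards [self_mem_nhdsWithin] with y hy
    simp only [fun x : ℝ => hrep x y hy, mul_add]
    have hsplit : Integrable fun x => φ x * ∫ t, (1 + t ^ 2) * halfPlaneKernel x y t ∂σ := by
      have hline : Continuous fun x : ℝ => f (x + y * Complex.I) :=
        hf.1.continuousOn.comp_continuous (by fun_prop) fun x => by
          simpa [upperHalf] using mem_Ioi.1 hy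
      have hcont : Continuous fun x : ℝ => φ x * ((f (x + y * Complex.I)).im - a * y) :=
        hφ.mul ((Complex.continuous_im.comp hline).sub continuous_const)
      refine (hcont.integrable_of_hasCompactSupport hc.mul_right).congr (ae_of_all _ fun x => ?_)
      simp only
      rw [hrep x y hy, add_sub_cancel_left]
    rw [integral_add (hi.mul_const _) hsplit, integral_mul_const, mul_comm]
  · rw [lintegral_withDensity_eq_lintegral_mul _ hm (by fun_prop)]
    have : ∀ t : ℝ, ((fun t : ℝ => ENNReal.ofReal (Real.pi * (1 + t ^ 2))) *
        fun t : ℝ => ENNReal.ofReal (1 + t ^ 2)⁻¹) t = ENNReal.ofReal Real.pi := fun t => by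
      rw [Pi.mul_apply, ← ENNReal.ofReal_mul (by positivity)]
      congr 1
      have : 1 + t ^ 2 ≠ 0 := by positivity
      field_simp
    simp only [this, lintegral_const]
    exact ENNReal.mul_lt_top ENNReal.ofReal_lt_top (measure_lt_top σ _)
  · have hc := continuous_halfPlaneKernel x hy
    have hk : ∀ t, 0 < halfPlaneKernel x y t := fun t => halfPlaneKernel_pos hy
    rw [lintegral_withDensity_eq_lintegral_mul _ hm (by fun_prop), hrep x y hy, mul_add,
      ENNReal.ofReal_add (by positivity) ?_, mul_assoc]
    · congr 1
      rw [← integral_const_mul, ofReal_integral_eq_lintegral_ofReal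
        ((integrable_one_add_sq_mul_halfPlaneKernel x hy).const_mul _)
        (ae_of_all _ fun t => by have := hk t; simp only [Pi.zero_apply]; positivity)]
      refine lintegral_congr fun t => ?_
      rw [Pi.mul_apply, ← ENNReal.ofReal_mul (by positivity), mul_assoc]
    · refine mul_nonneg (by positivity) (integral_nonneg fun t => ?_)
      have := hk t
      simp only [Pi.zero_apply]
      positivity

/-! ### Schwarz–Pick estimate -/

/-- Schwarz's lemma is applied to a Cayley transform of `f` on the disc of radius `Im z` about `z`
instead of the whole half plane; this costs a factor 2, which is harmless below. -/
theorem norm_deriv_le_of_mapsTo_upperHalf {f : ℂ → ℂ} (hf : AnalyticOnNhd ℂ f upperHalf)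
    (hm : MapsTo f upperHalf upperHalf) {z : ℂ} (hz : z ∈ upperHalf) :
    ‖deriv f z‖ ≤ 2 * (f z).im / z.im := by
  have hz' : 0 < z.im := hz
  have hω : 0 < (f z).im := hm hz
  set ω := f z with hωd
  have hsub : Metric.ball z z.im ⊆ upperHalf := fun u hu => by
    have h1 : |(u - z).im| < z.im :=
      (Complex.abs_im_le_norm _).trans_lt (mem_ball_iff_norm.1 hu)
    have := (abs_lt.1 h1).1
    simp only [Complex.sub_im] at this
    change 0 < u.im
    linarith
  have hden : ∀ u ∈ upperHalf, f u - (starRingEnd ℂ) ω ≠ 0 := fun u hu h => by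
    have h1 := congrArg Complex.im h
    have h2 : 0 < (f u).im := hm hu
    simp at h1
    linarith
  set G : ℂ → ℂ := fun u => (f u - ω) / (f u - (starRingEnd ℂ) ω) with hG
  have hGd : DifferentiableOn ℂ G (Metric.ball z z.im) := by
    have := hf.differentiableOn.mono hsub
    exact (this.sub_const _).div (this.sub_const _) fun u hu => hden u (hsub hu)
  have hGm : MapsTo G (Metric.ball z z.im) (Metric.ball (G z) 1) := fun u hu => by
    have h0 : G z = 0 := by simp [hG, hωd]
    rw [h0, mem_ball_zero_iff, hG]
    simp only
    rw [norm_div, div_lt_one (norm_pos_iff.2 (hden u (hsub hu)))]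
    refine lt_of_pow_lt_pow_left₀ 2 (norm_nonneg _) ?_
    rw [← Complex.normSq_eq_norm_sq, ← Complex.normSq_eq_norm_sq, Complex.normSq_apply,
      Complex.normSq_apply]
    have h2 : 0 < (f u).im := hm (hsub hu)
    simp
    nlinarith [mul_pos h2 hω]
  have h1 := Complex.norm_deriv_le_div_of_mapsTo_ball hGd
    (hGm.mono_right Metric.ball_subset_closedBall) hz'
  have hfd : HasDerivAt f (deriv f z) z := (hf z hz).differentiableAt.hasDerivAt
  have h2 : HasDerivAt G (deriv f z / (ω - (starRingEnd ℂ) ω)) z := by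
    have := (hfd.sub_const ω).div (hfd.sub_const ((starRingEnd ℂ) ω)) (hden z hz)
    refine HasDerivAt.congr_deriv (f := G) this ?_
    have h3 := hden z hz
    rw [← hωd] at h3 ⊢
    field_simp
    ring
  have h3 : ‖ω - (starRingEnd ℂ) ω‖ = 2 * ω.im := by
    rw [Complex.sub_conj]
    simp [abs_of_pos hω]
  rw [h2.deriv, norm_div, h3, div_le_div_iff₀ (by positivity) hz'] at h1
  rw [le_div_iff₀ hz']
  linarith

/-! ### Consequences of integrability of the inverse gauge -/

section Gauge

variable {γ : ℝ≥0 → ℝ≥0}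

theorem exists_le_mul_sq_of_isBigO (hmono : Monotone γ)
    (hO : (fun t => (γ t : ℝ)) =O[𝓝[>] (0 : ℝ≥0)] (fun t => (t : ℝ) ^ 2)) :
    γ 0 = 0 ∧ ∃ K : ℝ≥0, 0 < K ∧ ∃ δ : ℝ≥0, 0 < δ ∧ ∀ t < δ, γ t ≤ K * t ^ 2 := by
  obtain ⟨K, hK, hb⟩ := hO.exists_pos
  rw [Asymptotics.IsBigOWith] at hb
  obtain ⟨δ, hδ, hb⟩ := mem_nhdsGT_iff_exists_Ioo_subset.1 hb
  have hδ' : (0 : ℝ≥0) < δ := hδ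
  lift K to ℝ≥0 using hK.le
  have hb' : ∀ t : ℝ≥0, 0 < t → t < δ → γ t ≤ K * t ^ 2 := fun t h0 h1 => by
    have := hb ⟨h0, h1⟩
    simpa [← NNReal.coe_le_coe] using this
  have h0 : γ 0 = 0 := by
    by_contra h
    have hpos : 0 < γ 0 := pos_iff_ne_zero.2 h
    have hlim : Tendsto (fun t : ℝ≥0 => K * t ^ 2) (𝓝[>] 0) (𝓝 0) := by
      have : Continuous fun t : ℝ≥0 => K * t ^ 2 := by fun_prop
      simpa using (this.tendsto 0).mono_left nhdsWithin_le_nhds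
    obtain ⟨t, h1, h2⟩ := ((hlim.eventually (gt_mem_nhds hpos)).and
      (Ioo_mem_nhdsGT hδ')).exists
    exact absurd ((hmono h2.1.le).trans (hb' t h2.1 h2.2)) (not_le.2 h1)
  refine ⟨h0, K, by exact_mod_cast hK, δ, hδ', fun t ht => ?_⟩
  rcases eq_or_ne t 0 with rfl | h
  · simp [h0]
  · exact hb' t (pos_iff_ne_zero.2 h) ht

theorem measurable_inv_gauge (hmono : Monotone γ) (C : ℝ≥0) (τ : ℝ) :
    Measurable fun t : ℝ => (γ (C * nndist t τ) : ℝ≥0∞)⁻¹ := by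
  have := hmono.measurable
  fun_prop

variable {μ : Measure ℝ} {τ δ : ℝ} {C : ℝ≥0}

/-- A Chebyshev bound: `1 = γ · γ⁻¹`, and `γ` is at most its value at the outer radius. Points where
the gauge vanishes are `μ`-null because the integral is finite. -/
theorem measure_le_mul_lintegral_inv_gauge (hmono : Monotone γ)
    (hfin : ∫⁻ t in Metric.ball τ δ, (γ (C * nndist t τ) : ℝ≥0∞)⁻¹ ∂μ < ∞) {E : Set ℝ}
    (hE : E ⊆ Metric.ball τ δ) (hEm : MeasurableSet E) {R : ℝ≥0}
    (hR : ∀ t ∈ E, nndist t τ ≤ R) :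
    μ E ≤ γ (C * R) * ∫⁻ t in E, (γ (C * nndist t τ) : ℝ≥0∞)⁻¹ ∂μ := by
  have hm := measurable_inv_gauge hmono C τ
  have h1 : ∀ᵐ t ∂μ.restrict E, (γ (C * nndist t τ) : ℝ≥0∞)⁻¹ < ∞ :=
    ae_lt_top hm ((lintegral_mono_set hE).trans_lt hfin).ne
  rw [← lintegral_const_mul _ hm, ← setLIntegral_one]
  refine lintegral_mono_ae ?_
  filter_upwards [h1, ae_restrict_mem hEm] with t ht htE
  have h2 : (γ (C * nndist t τ) : ℝ≥0∞) ≠ 0 := fun h => by simp [h] at ht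
  rw [← ENNReal.mul_inv_cancel h2 ENNReal.coe_ne_top]
  gcongr
  exact hmono (mul_le_mul_right (hR t htE) C)

/-- As `1/γ(0) = ∞`, the point `τ` has no `μ`-mass, so continuity from above applies. This smallness
is what turns `O` into `o` in the boundary limit. -/
theorem tendsto_setLIntegral_inv_gauge (h0 : γ 0 = 0) (hmono : Monotone γ) (hδ : 0 < δ)
    (hfin : ∫⁻ t in Metric.ball τ δ, (γ (C * nndist t τ) : ℝ≥0∞)⁻¹ ∂μ < ∞) :
    Tendsto (fun r => ∫⁻ t in Metric.closedBall τ r, (γ (C * nndist t τ) : ℝ≥0∞)⁻¹ ∂μ)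
      (𝓝[>] 0) (𝓝 0) := by
  have hm := measurable_inv_gauge hmono C τ
  set ν := (μ.restrict (Metric.ball τ δ)).withDensity fun t => (γ (C * nndist t τ) : ℝ≥0∞)⁻¹
    with hν
  have hνE : ∀ E ⊆ Metric.ball τ δ, MeasurableSet E →
      ν E = ∫⁻ t in E, (γ (C * nndist t τ) : ℝ≥0∞)⁻¹ ∂μ := fun E hE hEm => by
    rw [hν, withDensity_apply _ hEm, Measure.restrict_restrict hEm, inter_eq_left.2 hE]
  have hνfin : ∀ E, ν E ≠ ∞ := fun E => by
    refine ((measure_mono (subset_univ E)).trans_lt ?_).ne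
    rw [hν, withDensity_apply _ MeasurableSet.univ, Measure.restrict_univ]
    exact hfin
  have hτ : ν {τ} = 0 := by
    have h1 := measure_le_mul_lintegral_inv_gauge hmono hfin (E := {τ}) (R := 0)
      (by simpa using hδ) (measurableSet_singleton τ) (by simp)
    rw [mul_zero, h0, ENNReal.coe_zero, zero_mul, nonpos_iff_eq_zero] at h1
    rw [hνE _ (by simpa using hδ) (measurableSet_singleton τ)]
    exact setLIntegral_measure_zero _ _ h1
  have h2 := tendsto_measure_cthickening_of_isClosed (μ := ν) (s := {τ})
    ⟨1, one_pos, hνfin _⟩ isClosed_singleton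
  rw [hτ] at h2
  refine (h2.mono_left nhdsWithin_le_nhds).congr' ?_
  filter_upwards [Ioo_mem_nhdsGT hδ] with r hr
  rw [Metric.cthickening_singleton _ hr.1.le, hνE _ (Metric.closedBall_subset_ball hr.2)
    Metric.isClosed_closedBall.measurableSet]

/-- Near `τ`, the bound `γ(t) = O(t²)` dominates `1/(t - τ)²` by a multiple of the inverse gauge;
far away it is comparable to `1/(1 + t²)`. -/
theorem lintegral_inv_sq_lt_top_of_regular (hmono : Monotone γ)
    (hO : (fun t => (γ t : ℝ)) =O[𝓝[>] (0 : ℝ≥0)] (fun t => (t : ℝ) ^ 2))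
    (hμ : ∫⁻ t, ENNReal.ofReal (1 + t ^ 2)⁻¹ ∂μ < ∞) (hC : 0 < C) (hδ : 0 < δ)
    (hfin : ∫⁻ t in Metric.ball τ δ, (γ (C * nndist t τ) : ℝ≥0∞)⁻¹ ∂μ < ∞) :
    ∫⁻ t, (ENNReal.ofReal ((t - τ) ^ 2))⁻¹ ∂μ < ∞ := by
  obtain ⟨-, K, hK, δ₁, hδ₁, hb⟩ := exists_le_mul_sq_of_isBigO hmono hO
  set d : ℝ := min δ (δ₁ / (C + 1)) with hd
  have hd0 : 0 < d := lt_min hδ (by positivity)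
  have hsq : ∀ t : ℝ, ENNReal.ofReal ((t - τ) ^ 2) = ((nndist t τ ^ 2 : ℝ≥0) : ℝ≥0∞) := fun t => by
    rw [ENNReal.ofReal, ENNReal.coe_inj, ← NNReal.coe_inj, Real.coe_toNNReal _ (sq_nonneg _)]
    simp [Real.dist_eq]
  rw [← lintegral_add_compl _ (Metric.isOpen_ball (x := τ) (ε := d)).measurableSet]
  refine ENNReal.add_lt_top.2 ⟨?_, ?_⟩
  · have h1 : ∀ t ∈ Metric.ball τ d, (ENNReal.ofReal ((t - τ) ^ 2))⁻¹ ≤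
        ((K * C ^ 2 : ℝ≥0) : ℝ≥0∞) * (γ (C * nndist t τ) : ℝ≥0∞)⁻¹ := fun t ht => by
      have h2 : C * nndist t τ < δ₁ := by
        rw [← NNReal.coe_lt_coe, NNReal.coe_mul, coe_nndist]
        have h3 : dist t τ < δ₁ / (C + 1) := (Metric.mem_ball.1 ht).trans_le (min_le_right _ _)
        rw [lt_div_iff₀ (by positivity)] at h3
        nlinarith [dist_nonneg (x := t) (y := τ)]
      have h3 := hb _ h2
      have h4 : ((K * C ^ 2 : ℝ≥0) : ℝ≥0∞) ≠ 0 := by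
        rw [ENNReal.coe_ne_zero]; positivity
      have h5 : (γ (C * nndist t τ) : ℝ≥0∞) ≤
          ((K * C ^ 2 : ℝ≥0) : ℝ≥0∞) * ((nndist t τ ^ 2 : ℝ≥0) : ℝ≥0∞) := by
        rw [← ENNReal.coe_mul, ENNReal.coe_le_coe]
        exact h3.trans_eq (by ring)
      calc (ENNReal.ofReal ((t - τ) ^ 2))⁻¹
          = ((K * C ^ 2 : ℝ≥0) : ℝ≥0∞) *
            (((K * C ^ 2 : ℝ≥0) : ℝ≥0∞) * ((nndist t τ ^ 2 : ℝ≥0) : ℝ≥0∞))⁻¹ := by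
            rw [hsq, ENNReal.mul_inv (Or.inl h4) (Or.inl ENNReal.coe_ne_top), ← mul_assoc,
              ENNReal.mul_inv_cancel h4 ENNReal.coe_ne_top, one_mul]
        _ ≤ _ := by gcongr
    refine (setLIntegral_mono' Metric.isOpen_ball.measurableSet h1).trans_lt ?_
    rw [lintegral_const_mul _ (measurable_inv_gauge hmono C τ)]
    exact ENNReal.mul_lt_top ENNReal.coe_lt_top ((lintegral_mono_set
      (Metric.ball_subset_ball (min_le_left _ _))).trans_lt hfin)
  · have h1 : ∀ t ∈ (Metric.ball τ d)ᶜ, (ENNReal.ofReal ((t - τ) ^ 2))⁻¹ ≤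
        ENNReal.ofReal (2 + (1 + 2 * τ ^ 2) / d ^ 2) * ENNReal.ofReal (1 + t ^ 2)⁻¹ := fun t ht => by
      have h2 : d ≤ |t - τ| := by simpa [Real.dist_eq] using ht
      have h3 : d ^ 2 ≤ (t - τ) ^ 2 := by rw [← sq_abs (t - τ)]; gcongr
      have h4 : 0 < (t - τ) ^ 2 := (pow_pos hd0 2).trans_le h3
      rw [← ENNReal.ofReal_inv_of_pos h4, ← ENNReal.ofReal_mul (by positivity)]
      refine ENNReal.ofReal_le_ofReal ?_
      rw [← div_eq_mul_inv, le_div_iff₀ (by positivity), inv_mul_eq_div, div_le_iff₀ h4, add_mul]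
      have h5 : 1 + 2 * τ ^ 2 ≤ (1 + 2 * τ ^ 2) / d ^ 2 * (t - τ) ^ 2 := by
        rw [div_mul_eq_mul_div, le_div_iff₀ (by positivity)]
        gcongr
      nlinarith [sq_nonneg (t - 2 * τ)]
    refine (setLIntegral_mono' Metric.isOpen_ball.measurableSet.compl h1).trans_lt ?_
    rw [lintegral_const_mul _ (by fun_prop)]
    exact ENNReal.mul_lt_top ENNReal.ofReal_lt_top ((setLIntegral_le_lintegral _ _).trans_lt hμ)

end Gauge

/-! ### Convergence in the region above the gauge -/

theorem HasNontangentialLimit.exists_forall_norm_sub_lt {f : ℂ → ℂ} {τ : ℝ} {w : ℂ}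
    (hw : HasNontangentialLimit f τ w) {ε : ℝ} (hε : 0 < ε) :
    ∃ ρ > 0, ∀ x y : ℝ, |x - τ| ≤ y → 0 < y → y < ρ → ‖f (x + y * Complex.I) - w‖ < ε := by
  -- If `|x - τ| ≤ y`, the distance to `τ` is at most `2y`; hence aperture `1/2`, and the halved
  -- radius below.
  have h1 := (hw (1 / 2) (by norm_num)) (Metric.ball_mem_nhds w hε)
  obtain ⟨ρ, hρ, hb⟩ := Metric.mem_nhdsWithin_iff.1 h1
  refine ⟨ρ / 2, by positivity, fun x y hxy hy hyρ => ?_⟩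
  have h2 : dist (x + y * Complex.I : ℂ) τ ≤ 2 * y := by
    rw [dist_eq_norm]
    refine (Complex.norm_le_abs_re_add_abs_im _).trans ?_
    simp only [Complex.sub_re, Complex.add_re, Complex.ofReal_re, Complex.mul_re, Complex.I_re,
      Complex.ofReal_im, Complex.I_im, Complex.sub_im, Complex.add_im, Complex.mul_im]
    simp only [mul_zero, mul_one, sub_zero, add_zero, zero_add, abs_of_pos hy]
    linarith
  have h3 := @hb (x + y * Complex.I : ℂ) ⟨Metric.mem_ball.2 (by linarith), ?_, ?_⟩
  · simpa [dist_eq_norm] using h3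
  · simpa [upperHalf] using hy
  · simp only [Complex.add_im, Complex.ofReal_im, Complex.mul_im, Complex.ofReal_re, Complex.I_im,
      mul_one, Complex.I_re, mul_zero, add_zero, zero_add]
    linarith

theorem ofReal_halfPlaneKernel_le {c τ x y t : ℝ} (hy : 0 < y) (hc : 0 < c)
    (h : |t - τ| ≤ c * |t - x|) :
    ENNReal.ofReal (halfPlaneKernel x y t) ≤
      ENNReal.ofReal (c ^ 2 * y) * (ENNReal.ofReal ((t - τ) ^ 2))⁻¹ := by
  rcases eq_or_ne t τ with rfl | hne
  -- At `t = τ` the right-hand side is `∞`.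
  · have : 0 < c ^ 2 * y := by positivity
    simp [ENNReal.mul_top, this]
  · have h3 : 0 < (t - τ) ^ 2 := by have := sub_ne_zero.2 hne; positivity
    rw [← ENNReal.ofReal_inv_of_pos h3, ← ENNReal.ofReal_mul (by positivity)]
    refine ENNReal.ofReal_le_ofReal ?_
    have h5 : (t - τ) ^ 2 ≤ c ^ 2 * (t - x) ^ 2 := by
      rw [← sq_abs (t - τ), ← sq_abs (t - x), ← mul_pow]
      gcongr
    rw [halfPlaneKernel, ← div_eq_mul_inv, div_le_div_iff₀ (by positivity) h3]
    nlinarith [mul_nonneg (sq_nonneg c) (sq_nonneg y)]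

section Poisson

variable {f : ℂ → ℂ} {a τ : ℝ} {μ : Measure ℝ}

/-- Off the ball, `|t - τ| ≤ 3|t - x|`, so the kernel is at most `9y/(t - τ)²`; on the ball it is at
most `1/y`. For `x = τ` the ball is empty and the bound is linear in `y`. -/
theorem IsPoissonMeasure.exists_im_le (hP : IsPoissonMeasure f a μ)
    (hA : ∫⁻ t, (ENNReal.ofReal ((t - τ) ^ 2))⁻¹ ∂μ < ∞) :
    ∃ K : ℝ, 0 ≤ K ∧ ∀ x y : ℝ, 0 < y →
      ENNReal.ofReal (Real.pi * (f (x + y * Complex.I)).im) ≤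
        ENNReal.ofReal (K * y) + ENNReal.ofReal y⁻¹ * μ (Metric.ball x (|x - τ| / 2)) := by
  set A := ∫⁻ t, (ENNReal.ofReal ((t - τ) ^ 2))⁻¹ ∂μ with hAdef
  have ha := hP.1
  refine ⟨a + 9 * A.toReal, by positivity, fun x y hy => ?_⟩
  have hbm : MeasurableSet (Metric.ball x (|x - τ| / 2)) := Metric.isOpen_ball.measurableSet
  have hm : Measurable fun t : ℝ => (ENNReal.ofReal ((t - τ) ^ 2))⁻¹ := by fun_prop
  have hfar : ∫⁻ t in (Metric.ball x (|x - τ| / 2))ᶜ, ENNReal.ofReal (halfPlaneKernel x y t) ∂μ ≤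
      ENNReal.ofReal (9 * y) * A := by
    have h1 : ∀ t ∈ (Metric.ball x (|x - τ| / 2))ᶜ, ENNReal.ofReal (halfPlaneKernel x y t) ≤
        ENNReal.ofReal (9 * y) * (ENNReal.ofReal ((t - τ) ^ 2))⁻¹ := fun t ht => by
      have h2 : |x - τ| / 2 ≤ |t - x| := by simpa [Real.dist_eq] using ht
      have h3 := ofReal_halfPlaneKernel_le (c := 3) (τ := τ) (t := t) (x := x) hy (by norm_num)
        (by linarith [abs_sub_le t x τ])
      rwa [show (3 : ℝ) ^ 2 = 9 by norm_num] at h3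
    refine (setLIntegral_mono' hbm.compl h1).trans ?_
    rw [lintegral_const_mul _ hm]
    gcongr
    exact setLIntegral_le_lintegral _ _
  have hnear : ∫⁻ t in Metric.ball x (|x - τ| / 2), ENNReal.ofReal (halfPlaneKernel x y t) ∂μ ≤
      ENNReal.ofReal y⁻¹ * μ (Metric.ball x (|x - τ| / 2)) := by
    rw [← setLIntegral_const]
    exact lintegral_mono fun t => ENNReal.ofReal_le_ofReal (halfPlaneKernel_le hy)
  rw [hP.2.2 x y hy, ← lintegral_add_compl _ hbm, add_mul,
    ENNReal.ofReal_add (by positivity) (by positivity), add_assoc, add_comm (∫⁻ _ in _, _ ∂μ)]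
  gcongr
  refine hfar.trans_eq ?_
  rw [mul_right_comm, ENNReal.ofReal_mul (by positivity) (p := 9 * y),
    ENNReal.ofReal_toReal hA.ne]

theorem IsPoissonMeasure.norm_sub_le [IsLocallyFiniteMeasure μ] (hf : AnalyticOnNhd ℂ f upperHalf)
    (hm : MapsTo f upperHalf upperHalf) {K : ℝ} (hK : 0 ≤ K)
    (hb : ∀ x y : ℝ, 0 < y → ENNReal.ofReal (Real.pi * (f (x + y * Complex.I)).im) ≤
        ENNReal.ofReal (K * y) + ENNReal.ofReal y⁻¹ * μ (Metric.ball x (|x - τ| / 2)))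
    {x y s : ℝ} (hy : 0 < y) (hys : y ≤ s) :
    ‖f (x + s * Complex.I) - f (x + y * Complex.I)‖ ≤
      K * s + μ.real (Metric.ball x (|x - τ| / 2)) * y⁻¹ := by
  set m := μ.real (Metric.ball x (|x - τ| / 2)) with hmdef
  have hm0 : 0 ≤ m := measureReal_nonneg
  -- The 2 of the Schwarz–Pick estimate is absorbed by the factor `π`.
  have him : ∀ v : ℝ, 0 < v → 2 * (f (x + v * Complex.I)).im ≤ K * v + v⁻¹ * m := fun v hv => by
    have h1 := hb x v hv
    rw [← ofReal_measureReal (measure_ball_lt_top.ne), ← hmdef,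
      ← ENNReal.ofReal_mul (by positivity), ← ENNReal.ofReal_add (by positivity) (by positivity),
      ENNReal.ofReal_le_ofReal_iff (by positivity)] at h1
    have h2 : 0 < (f (x + v * Complex.I)).im := hm (by simpa [upperHalf] using hv)
    nlinarith [Real.pi_gt_three]
  have hmem : ∀ v : ℝ, 0 < v → (x + v * Complex.I : ℂ) ∈ upperHalf := fun v hv => by
    simpa [upperHalf] using hv
  have hder : ∀ v : ℝ, 0 < v → HasDerivAt (fun v : ℝ => f (x + v * Complex.I))
      (deriv f (x + v * Complex.I) * Complex.I) v := fun v hv => by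
    have h1 := (hf _ (hmem v hv)).differentiableAt.hasDerivAt
    have h2 : HasDerivAt (fun v : ℝ => (x + v * Complex.I : ℂ)) Complex.I v := by
      simpa using (((hasDerivAt_id v).ofReal_comp).mul_const Complex.I).const_add (x : ℂ)
    simpa [mul_comm, Function.comp_def] using HasDerivAt.scomp v h1 h2
  have hB : ∀ v : ℝ, 0 < v →
      HasDerivAt (fun v => K * (v - y) + m * (y⁻¹ - v⁻¹)) (K + m * (v ^ 2)⁻¹) v := fun v hv => by
    have h1 := (((hasDerivAt_id v).sub_const y).const_mul K).add
      (((hasDerivAt_inv hv.ne').const_sub y⁻¹).const_mul m)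
    refine HasDerivAt.congr_deriv (f := fun v => K * (v - y) + m * (y⁻¹ - v⁻¹)) h1 (by simp)
  have hpos : ∀ v ∈ Icc y s, 0 < v := fun v hv => hy.trans_le hv.1
  -- Integrates `|f'| ≤ K + m/v²` from `y` up to `s`.
  have key := image_norm_le_of_norm_deriv_right_le_deriv_boundary'
    (f := fun v : ℝ => f (x + v * Complex.I) - f (x + y * Complex.I))
    (f' := fun v => deriv f (x + v * Complex.I) * Complex.I) (a := y) (b := s)
    (B := fun v => K * (v - y) + m * (y⁻¹ - v⁻¹)) (B' := fun v => K + m * (v ^ 2)⁻¹)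
    (fun v hv => ((hder v (hpos v hv)).sub_const _).continuousAt.continuousWithinAt)
    (fun v hv => ((hder v (hpos v (Ico_subset_Icc_self hv))).sub_const _).hasDerivWithinAt)
    (by simp)
    (fun v hv => (hB v (hpos v hv)).continuousAt.continuousWithinAt)
    (fun v hv => (hB v (hpos v (Ico_subset_Icc_self hv))).hasDerivWithinAt)
    (fun v hv => by
      have hv0 := hpos v (Ico_subset_Icc_self hv)
      have h1 := norm_deriv_le_of_mapsTo_upperHalf hf hm (hmem v hv0)
      have h2 : (x + v * Complex.I : ℂ).im = v := by simp
      rw [h2] at h1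
      rw [norm_mul, Complex.norm_I, mul_one]
      refine h1.trans ?_
      rw [div_le_iff₀ hv0]
      refine (him v hv0).trans_eq ?_
      field_simp)
    (right_mem_Icc.2 hys)
  refine key.trans ?_
  have hs : 0 < s⁻¹ := inv_pos.2 (hy.trans_le hys)
  nlinarith [mul_nonneg hK hy.le, mul_nonneg hm0 hs.le]

theorem exists_forall_norm_sub_lt_of_regular {γ : ℝ≥0 → ℝ≥0} (hmono : Monotone γ)
    (hO : (fun t => (γ t : ℝ)) =O[𝓝[>] (0 : ℝ≥0)] (fun t => (t : ℝ) ^ 2))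
    [IsLocallyFiniteMeasure μ] (hf : AnalyticOnNhd ℂ f upperHalf)
    (hm : MapsTo f upperHalf upperHalf) (hP : IsPoissonMeasure f a μ) {C : ℝ≥0} (hC : 0 < C)
    {δ : ℝ} (hδ : 0 < δ)
    (hfin : ∫⁻ t in Metric.ball τ δ, (γ (C * nndist t τ) : ℝ≥0∞)⁻¹ ∂μ < ∞)
    {w : ℂ} (hw : HasNontangentialLimit f τ w) {ε : ℝ} (hε : 0 < ε) :
    ∃ ρ > 0, ∀ x y : ℝ, |x - τ| < ρ → 0 < y → y < ρ → (γ (2 * C * nndist x τ) : ℝ) ≤ y →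
      ‖f (x + y * Complex.I) - w‖ < ε := by
  obtain ⟨h0, -⟩ := exists_le_mul_sq_of_isBigO hmono hO
  have hA := lintegral_inv_sq_lt_top_of_regular hmono hO hP.2.1 hC hδ hfin
  obtain ⟨K, hK, hb⟩ := hP.exists_im_le hA
  obtain ⟨ρ₁, hρ₁, hnt⟩ := hw.exists_forall_norm_sub_lt (half_pos hε)
  have hη := tendsto_setLIntegral_inv_gauge h0 hmono hδ hfin
  have hε4 : (0 : ℝ≥0∞) < ENNReal.ofReal (ε / 4) := ENNReal.ofReal_pos.2 (by linarith)
  obtain ⟨r, hr, hrδ⟩ := ((hη.eventually (gt_mem_nhds hε4)).and (Ioo_mem_nhdsGT hδ)).exists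
  have hr0 : 0 < r := hrδ.1
  refine ⟨min ρ₁ (min (r / 2) (ε / (4 * (K + 1)))), by positivity, fun x y hx hy hyρ hγ => ?_⟩
  have hx1 : |x - τ| < ρ₁ := hx.trans_le (min_le_left _ _)
  have hx2 : |x - τ| < r / 2 := hx.trans_le ((min_le_right _ _).trans (min_le_left _ _))
  have hx3 : |x - τ| < ε / (4 * (K + 1)) :=
    hx.trans_le ((min_le_right _ _).trans (min_le_right _ _))
  have hy1 : y < ρ₁ := hyρ.trans_le (min_le_left _ _)
  rcases le_or_gt |x - τ| y with hxy | hxy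
  · linarith [hnt x y hxy hy hy1]
  -- Below the cone, `f(x + iy)` is compared with the value on the cone's boundary straight above,
  -- at height `s`.
  set s := |x - τ| with hs
  have hs0 : 0 < s := hy.trans hxy
  have h1 := hnt x s le_rfl hs0 hx1
  have h2 := IsPoissonMeasure.norm_sub_le hf hm hK hb (x := x) hy hxy.le
  have hE : Metric.ball x (s / 2) ⊆ Metric.closedBall τ r := fun t ht => by
    rw [Metric.mem_ball, Real.dist_eq] at ht
    rw [Metric.mem_closedBall, Real.dist_eq]
    linarith [abs_sub_le t x τ]
  -- The ball about `x` lies within distance `3s/2 ≤ 2s` of `τ`; this is the source of the constant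
  -- `2 * C`.
  have h3 := measure_le_mul_lintegral_inv_gauge hmono hfin
    (hE.trans (Metric.closedBall_subset_ball hrδ.2)) Metric.isOpen_ball.measurableSet
    (R := 2 * nndist x τ) (fun t ht => by
      rw [← NNReal.coe_le_coe, NNReal.coe_mul, coe_nndist, coe_nndist, Real.dist_eq, Real.dist_eq,
        ← hs]
      rw [Metric.mem_ball, Real.dist_eq] at ht
      norm_num
      linarith [abs_sub_le t x τ])
  have h4 : μ (Metric.ball x (s / 2)) ≤ ENNReal.ofReal y * ENNReal.ofReal (ε / 4) := by
    refine h3.trans (mul_le_mul' ?_ ((lintegral_mono_set hE).trans hr.le))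
    rw [← ENNReal.ofReal_coe_nnreal, mul_left_comm, ← mul_assoc]
    exact ENNReal.ofReal_le_ofReal hγ
  rw [← ENNReal.ofReal_mul hy.le] at h4
  have h5 : μ.real (Metric.ball x (s / 2)) ≤ y * (ε / 4) :=
    ENNReal.toReal_le_of_le_ofReal (by positivity) h4
  have h6 : μ.real (Metric.ball x (s / 2)) * y⁻¹ ≤ ε / 4 := by
    rw [← div_eq_mul_inv, div_le_iff₀ hy]; linarith
  have h7 : K * s < ε / 4 := by
    rw [lt_div_iff₀ (by positivity)] at hx3
    nlinarith
  have h8 := norm_sub_le_norm_sub_add_norm_sub (f (x + y * Complex.I)) (f (x + s * Complex.I)) w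
  rw [norm_sub_rev (f (x + y * Complex.I)) (f (x + s * Complex.I))] at h8
  linarith

end Poisson

/-! ### Dyadic shells -/

/-- The set of real numbers whose distance to `τ` lies in `(r, s]`. -/
def shell (τ r s : ℝ) : Set ℝ := {t | r < |t - τ| ∧ |t - τ| ≤ s}

theorem measurableSet_shell (τ r s : ℝ) : MeasurableSet (shell τ r s) := by
  have hc : Continuous fun t : ℝ => |t - τ| := by fun_prop
  exact ((isOpen_lt continuous_const hc).measurableSet).inter
    (isClosed_le hc continuous_const).measurableSet

theorem shell_subset_ball {τ r s δ : ℝ} (h : s < δ) : shell τ r s ⊆ Metric.ball τ δ :=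
  fun t ht => by
    rw [Metric.mem_ball, Real.dist_eq]
    exact ht.2.trans_lt h

theorem shell_subset_iUnion (τ r : ℝ) :
    shell τ (r / 4) (4 * r) ⊆ ⋃ i : Fin 4, shell τ (2 * r / 2 ^ (i : ℕ)) (4 * r / 2 ^ (i : ℕ)) := by
  intro t ht
  obtain ⟨h1, h2⟩ := ht
  simp only [mem_iUnion, shell, mem_ofPred_eq]
  by_cases h3 : 2 * r < |t - τ|
  · exact ⟨0, by norm_num; exact ⟨h3, h2⟩⟩
  by_cases h4 : r < |t - τ|
  · exact ⟨1, by norm_num; constructor <;> linarith⟩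
  by_cases h5 : r / 2 < |t - τ|
  · exact ⟨2, by norm_num; constructor <;> linarith⟩
  · exact ⟨3, by norm_num; constructor <;> linarith⟩

theorem pairwise_disjoint_dyadic_shell (τ d : ℝ) :
    Pairwise (Function.onFun Disjoint fun k : ℕ => shell τ (d / 2 ^ k) (2 * d / 2 ^ k)) := by
  have key : ∀ i j : ℕ, i < j →
      Disjoint (shell τ (d / 2 ^ i) (2 * d / 2 ^ i)) (shell τ (d / 2 ^ j) (2 * d / 2 ^ j)) := by
    intro i j hij
    rw [Set.disjoint_left]
    intro t h1 h2
    have hd : 0 < d := by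
      have := h1.1.trans_le h1.2
      have h3 := (div_lt_div_iff_of_pos_right (pow_pos (two_pos (α := ℝ)) i)).1 this
      linarith
    have h4 : 2 * d / 2 ^ j ≤ d / 2 ^ i := by
      rw [div_le_div_iff₀ (by positivity) (by positivity)]
      have : (2 : ℝ) ^ (i + 1) ≤ 2 ^ j := pow_le_pow_right₀ (by norm_num) hij
      rw [pow_succ] at this
      nlinarith
    exact absurd (h1.1.trans_le (h2.2.trans h4)) (lt_irrefl _)
  intro i j hij
  rcases lt_or_gt_of_ne hij with h | h
  · exact key i j h
  · exact (key j i h).symm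

theorem ball_subset_iUnion_shell {τ d : ℝ} (hd : 0 < d) :
    Metric.ball τ d ⊆ {τ} ∪ ⋃ k : ℕ, shell τ (d / 2 ^ k) (2 * d / 2 ^ k) := by
  intro t ht
  rw [Metric.mem_ball, Real.dist_eq] at ht
  rcases eq_or_ne t τ with rfl | hne
  · simp
  right
  have h0 : 0 < |t - τ| := abs_pos.2 (sub_ne_zero.2 hne)
  obtain ⟨n, h1, h2⟩ := exists_nat_pow_near_of_lt_one (x := |t - τ| / d) (y := 1 / 2)
    (by positivity) ((div_le_one hd).2 ht.le) (by norm_num) (by norm_num)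
  rw [lt_div_iff₀ hd] at h1
  rw [div_le_iff₀ hd] at h2
  refine mem_iUnion.2 ⟨n + 1, ?_, ?_⟩
  · refine lt_of_eq_of_lt ?_ h1
    rw [div_pow, one_pow]; ring
  · refine h2.trans_eq ?_
    rw [div_pow, one_pow, pow_succ]
    field_simp

theorem half_le_setLIntegral_halfPlaneKernel {y t : ℝ} {E : Set ℝ} (hy : 0 < y)
    (hE : Icc t (t + y) ⊆ E) :
    ENNReal.ofReal (1 / 2) ≤ ∫⁻ x in E, ENNReal.ofReal (halfPlaneKernel x y t) := by
  refine le_trans ?_ (lintegral_mono_set hE)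
  have h1 : ∀ x ∈ Icc t (t + y),
      ENNReal.ofReal (1 / (2 * y)) ≤ ENNReal.ofReal (halfPlaneKernel x y t) := fun x hx => by
    refine ENNReal.ofReal_le_ofReal ?_
    rw [halfPlaneKernel, div_le_div_iff₀ (by positivity) (by positivity)]
    nlinarith [hx.1, hx.2]
  refine le_trans (le_of_eq ?_) (setLIntegral_mono' measurableSet_Icc h1)
  rw [setLIntegral_const, Real.volume_Icc, ← ENNReal.ofReal_mul (by positivity)]
  congr 1
  field_simp
  ring

theorem lintegral_halfPlaneKernel {y : ℝ} (hy : 0 < y) (t : ℝ) :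
    ∫⁻ x, ENNReal.ofReal (halfPlaneKernel x y t) = ENNReal.ofReal Real.pi := by
  rw [← integral_halfPlaneKernel hy t, ofReal_integral_eq_lintegral_ofReal
    (integrable_halfPlaneKernel hy t) (ae_of_all _ fun x => (halfPlaneKernel_pos hy).le)]

/-! ### Comparing measures of shells through imaginary parts -/

section Transfer

variable {f h : ℂ → ℂ} {a b τ : ℝ} {μ ν : Measure ℝ}

theorem measurable_ofReal_halfPlaneKernel {y : ℝ} (hy : 0 < y) :
    Measurable (fun p : ℝ × ℝ => ENNReal.ofReal (halfPlaneKernel p.1 y p.2)) :=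
  ENNReal.measurable_ofReal.comp (continuous_halfPlaneKernel_uncurry hy).measurable

/-- Tonelli: each `t` in the shell gives kernel mass at least `1/2` to `[t, t + y]`, and `y ≤ r/2`
keeps this interval in the larger shell. -/
theorem IsPoissonMeasure.half_mul_measure_shell_le [SFinite ν] (hh : IsPoissonMeasure h b ν)
    {r y : ℝ} (hy : 0 < y) (hyr : y ≤ r / 2) :
    ENNReal.ofReal (1 / 2) * ν (shell τ r (2 * r)) ≤
      ∫⁻ x in shell τ (r / 2) (3 * r),
        ENNReal.ofReal (Real.pi * (h (x + y * Complex.I)).im) := by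
  have hkm' : Measurable (fun p : ℝ × ℝ => ENNReal.ofReal (halfPlaneKernel p.2 y p.1)) := by
    have := (measurable_ofReal_halfPlaneKernel hy).comp (measurable_swap (α := ℝ) (β := ℝ))
    simpa only [Function.comp_def, Prod.fst_swap, Prod.snd_swap] using this
  have h1 : ENNReal.ofReal (1 / 2) * ν (shell τ r (2 * r)) ≤
      ∫⁻ t in shell τ r (2 * r), (∫⁻ x in shell τ (r / 2) (3 * r),
          ENNReal.ofReal (halfPlaneKernel x y t)) ∂ν := by
    rw [← setLIntegral_const]
    refine setLIntegral_mono' (measurableSet_shell _ _ _) fun t ht => ?_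
    refine half_le_setLIntegral_halfPlaneKernel hy fun x hx => ?_
    obtain ⟨h1, h2⟩ := ht
    obtain ⟨h3, h4⟩ := hx
    rcases abs_cases (t - τ) with ⟨e, _⟩ | ⟨e, _⟩ <;> rw [e] at h1 h2 <;>
      rcases abs_cases (x - τ) with ⟨e', _⟩ | ⟨e', _⟩ <;> constructor <;> linarith
  rw [lintegral_lintegral_swap (f := fun t x => ENNReal.ofReal (halfPlaneKernel x y t))
    hkm'.aemeasurable] at h1
  refine h1.trans (lintegral_mono fun x => ?_)
  rw [hh.2.2 x y hy]
  exact (setLIntegral_le_lintegral _ _).trans le_add_self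

theorem IsPoissonMeasure.exists_im_le_of_mem_shell (hf : IsPoissonMeasure f a μ)
    (hA : ∫⁻ t, (ENNReal.ofReal ((t - τ) ^ 2))⁻¹ ∂μ < ∞) :
    ∃ L : ℝ, 0 ≤ L ∧ ∀ r y : ℝ, 0 < y → ∀ x ∈ shell τ (r / 2) (3 * r),
      ENNReal.ofReal (Real.pi * (f (x + y * Complex.I)).im) ≤ ENNReal.ofReal (L * y) +
        ∫⁻ t in shell τ (r / 4) (4 * r), ENNReal.ofReal (halfPlaneKernel x y t) ∂μ := by
  set A := ∫⁻ t, (ENNReal.ofReal ((t - τ) ^ 2))⁻¹ ∂μ with hAdef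
  have ha := hf.1
  refine ⟨a + 16 * A.toReal, by positivity, fun r y hy x hx => ?_⟩
  have hNm : MeasurableSet (shell τ (r / 4) (4 * r)) := measurableSet_shell _ _ _
  have hm : Measurable fun t : ℝ => (ENNReal.ofReal ((t - τ) ^ 2))⁻¹ := by fun_prop
  have hfar : ∫⁻ t in (shell τ (r / 4) (4 * r))ᶜ, ENNReal.ofReal (halfPlaneKernel x y t) ∂μ ≤
      ENNReal.ofReal (16 * y) * A := by
    have h1 : ∀ t ∈ (shell τ (r / 4) (4 * r))ᶜ, ENNReal.ofReal (halfPlaneKernel x y t) ≤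
        ENNReal.ofReal (16 * y) * (ENNReal.ofReal ((t - τ) ^ 2))⁻¹ := fun t ht => by
      -- Outside the enlarged shell `t` is either much closer to `τ` than `x` is or much farther;
      -- both cases give the constant 4.
      have h2 : |t - τ| ≤ 4 * |t - x| := by
        have h3 : r / 4 < |t - τ| → 4 * r < |t - τ| := fun h4 => by
          by_contra h5
          exact ht ⟨h4, not_lt.1 h5⟩
        obtain ⟨h6, h7⟩ := hx
        have h8 := abs_sub_le t x τ
        have h9 := abs_sub_le x t τ
        rw [abs_sub_comm x t] at h9
        rcases le_or_gt |t - τ| (r / 4) with h4 | h4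
        · linarith
        · linarith [h3 h4]
      have h3 := ofReal_halfPlaneKernel_le hy (by norm_num) h2
      rwa [show (4 : ℝ) ^ 2 = 16 by norm_num] at h3
    refine (setLIntegral_mono' hNm.compl h1).trans ?_
    rw [lintegral_const_mul _ hm]
    gcongr
    exact setLIntegral_le_lintegral _ _
  rw [hf.2.2 x y hy, ← lintegral_add_compl _ hNm, add_mul,
    ENNReal.ofReal_add (by positivity) (by positivity), add_assoc,
    add_comm (∫⁻ _ in shell _ _ _, _ ∂μ)]
  gcongr
  refine hfar.trans_eq ?_
  rw [mul_right_comm, ENNReal.ofReal_mul (by positivity) (p := 16 * y),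
    ENNReal.ofReal_toReal hA.ne]

theorem setLIntegral_setLIntegral_halfPlaneKernel_le [SFinite μ] {y : ℝ} (hy : 0 < y)
    (E N : Set ℝ) :
    ∫⁻ x in E, ∫⁻ t in N, ENNReal.ofReal (halfPlaneKernel x y t) ∂μ ≤
      ENNReal.ofReal Real.pi * μ N := by
  rw [lintegral_lintegral_swap (measurable_ofReal_halfPlaneKernel hy).aemeasurable,
    ← setLIntegral_const]
  refine lintegral_mono fun t => ?_
  rw [← lintegral_halfPlaneKernel hy t]
  exact setLIntegral_le_lintegral _ _

theorem volume_shell_le (τ r s : ℝ) : volume (shell τ r s) ≤ ENNReal.ofReal (2 * s) := by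
  have : shell τ r s ⊆ Icc (τ - s) (τ + s) := fun x hx => by
    have := abs_le.1 hx.2
    constructor <;> linarith [this.1, this.2]
  refine (measure_mono this).trans_eq ?_
  rw [Real.volume_Icc]
  congr 1; ring

/-- The inequality of imaginary parts is integrated at the single height `y`. The part of `μ`
outside the enlarged shell adds `O(y)` pointwise, hence `O(r y)` over a shell of length `O(r)`. -/
theorem IsPoissonMeasure.measure_shell_le [SFinite μ] [SFinite ν] (hf : IsPoissonMeasure f a μ)
    (hh : IsPoissonMeasure h b ν) (hA : ∫⁻ t, (ENNReal.ofReal ((t - τ) ^ 2))⁻¹ ∂μ < ∞)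
    {K : ℝ} (hK : 0 ≤ K) :
    ∃ B : ℝ≥0, ∀ r y : ℝ, 0 < y → y ≤ r / 2 →
      (∀ x : ℝ, |x - τ| ≤ 3 * r →
        (h (x + y * Complex.I)).im ≤ K * (f (x + y * Complex.I)).im) →
      ν (shell τ r (2 * r)) ≤ B * (μ (shell τ (r / 4) (4 * r)) + ENNReal.ofReal (r * y)) := by
  obtain ⟨L, hL0, hL⟩ := hf.exists_im_le_of_mem_shell hA
  have hπ := Real.pi_pos
  refine ⟨(2 * K * (Real.pi + 6 * L)).toNNReal, fun r y hy hyr him => ?_⟩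
  have hr : 0 < r := by linarith
  set m := μ (shell τ (r / 4) (4 * r)) with hm
  have hmain : ENNReal.ofReal (1 / 2) * ν (shell τ r (2 * r)) ≤ ENNReal.ofReal K *
      (ENNReal.ofReal (L * y) * ENNReal.ofReal (2 * (3 * r)) + ENNReal.ofReal Real.pi * m) := by
    refine (hh.half_mul_measure_shell_le hy hyr).trans ?_
    calc ∫⁻ x in shell τ (r / 2) (3 * r), ENNReal.ofReal (Real.pi * (h (x + y * Complex.I)).im)
        ≤ ∫⁻ x in shell τ (r / 2) (3 * r), ENNReal.ofReal K * (ENNReal.ofReal (L * y) +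
            ∫⁻ t in shell τ (r / 4) (4 * r), ENNReal.ofReal (halfPlaneKernel x y t) ∂μ) := by
          refine setLIntegral_mono' (measurableSet_shell _ _ _) fun x hx => ?_
          refine le_trans ?_ (mul_le_mul_right (hL r y hy x hx) _)
          rw [← ENNReal.ofReal_mul hK]
          refine ENNReal.ofReal_le_ofReal ?_
          nlinarith [him x hx.2]
      _ = ENNReal.ofReal K * (ENNReal.ofReal (L * y) * volume (shell τ (r / 2) (3 * r)) +
            ∫⁻ x in shell τ (r / 2) (3 * r), ∫⁻ t in shell τ (r / 4) (4 * r),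
              ENNReal.ofReal (halfPlaneKernel x y t) ∂μ) := by
          rw [lintegral_const_mul' _ _ ENNReal.ofReal_ne_top, lintegral_add_left measurable_const,
            setLIntegral_const]
      _ ≤ _ := by
          gcongr
          · exact volume_shell_le _ _ _
          · exact setLIntegral_setLIntegral_halfPlaneKernel_le hy _ _
  calc ν (shell τ r (2 * r))
      = ENNReal.ofReal 2 * (ENNReal.ofReal (1 / 2) * ν (shell τ r (2 * r))) := by
        rw [← mul_assoc, ← ENNReal.ofReal_mul (by norm_num)]; norm_num
    _ ≤ ENNReal.ofReal 2 * (ENNReal.ofReal K *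
      (ENNReal.ofReal (L * y) * ENNReal.ofReal (2 * (3 * r)) + ENNReal.ofReal Real.pi * m)) := by
        gcongr
    _ = ENNReal.ofReal (2 * K) * (ENNReal.ofReal Real.pi * m +
          ENNReal.ofReal (6 * L) * ENNReal.ofReal (r * y)) := by
        rw [← mul_assoc, ← ENNReal.ofReal_mul (by norm_num), add_comm,
          ← ENNReal.ofReal_mul (by positivity), ← ENNReal.ofReal_mul (by positivity)]
        congr 3
        ring_nf
    _ ≤ ENNReal.ofReal (2 * K) * (ENNReal.ofReal (Real.pi + 6 * L) * m +
          ENNReal.ofReal (Real.pi + 6 * L) * ENNReal.ofReal (r * y)) := by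
        gcongr <;> linarith
    _ = _ := by
        rw [← mul_add, ← mul_assoc, ← ENNReal.ofReal_mul (by positivity)]
        rfl

/-- An atom at `τ` would make `π Im h(τ + iy)` at least `ν {τ} / y`, whereas the comparison with `f`
makes it `O(y)`. -/
theorem IsPoissonMeasure.measure_singleton_eq_zero (hf : IsPoissonMeasure f a μ)
    (hh : IsPoissonMeasure h b ν) (hA : ∫⁻ t, (ENNReal.ofReal ((t - τ) ^ 2))⁻¹ ∂μ < ∞)
    {K ρ : ℝ} (hK : 0 ≤ K) (hρ : 0 < ρ)
    (him : ∀ y : ℝ, 0 < y → y < ρ →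
      (h (τ + y * Complex.I)).im ≤ K * (f (τ + y * Complex.I)).im) :
    ν {τ} = 0 := by
  obtain ⟨L, hL, hb⟩ := hf.exists_im_le hA
  have h1 : ∀ y : ℝ, 0 < y → y < ρ → ν {τ} ≤ ENNReal.ofReal (y * (K * (L * y))) := by
    intro y hy hyρ
    have h2 : ENNReal.ofReal (Real.pi * (h (τ + y * Complex.I)).im) ≤
        ENNReal.ofReal (K * (L * y)) := by
      have h3 := hb τ y hy
      simp only [sub_self, abs_zero, zero_div, Metric.ball_zero, measure_empty, mul_zero,
        add_zero] at h3
      rw [ENNReal.ofReal_le_ofReal_iff (by positivity)] at h3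
      refine ENNReal.ofReal_le_ofReal ?_
      nlinarith [him y hy hyρ, Real.pi_pos]
    have h4 : ENNReal.ofReal y⁻¹ * ν {τ} ≤
        ENNReal.ofReal (Real.pi * (h (τ + y * Complex.I)).im) := by
      rw [hh.2.2 τ y hy]
      refine le_trans ?_ ((setLIntegral_le_lintegral {τ} _).trans le_add_self)
      rw [lintegral_singleton, halfPlaneKernel]
      refine le_of_eq ?_
      congr 2
      have := hy.ne'
      field_simp
      ring
    calc ν {τ} = ENNReal.ofReal y * (ENNReal.ofReal y⁻¹ * ν {τ}) := by
          rw [← mul_assoc, ← ENNReal.ofReal_mul hy.le, mul_inv_cancel₀ hy.ne']; simp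
      _ ≤ ENNReal.ofReal y * ENNReal.ofReal (K * (L * y)) := by gcongr; exact h4.trans h2
      _ = _ := by rw [ENNReal.ofReal_mul hy.le]
  have h2 : Tendsto (fun y : ℝ => ENNReal.ofReal (y * (K * (L * y)))) (𝓝[>] 0) (𝓝 0) := by
    have hc : Continuous fun y : ℝ => ENNReal.ofReal (y * (K * (L * y))) :=
      ENNReal.continuous_ofReal.comp (by fun_prop)
    simpa using (hc.tendsto 0).mono_left nhdsWithin_le_nhds
  refine nonpos_iff_eq_zero.1 (ge_of_tendsto h2 ?_)
  filter_upwards [Ioo_mem_nhdsGT hρ] with y hy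
  exact h1 y hy.1 hy.2

end Transfer

/-! ### Transfer of regularity -/

section GaugeTransfer

variable {γ : ℝ≥0 → ℝ≥0} {f h : ℂ → ℂ} {a b τ : ℝ} {μ ν : Measure ℝ}

theorem exists_setLIntegral_shell_inv_gauge_le (hmono : Monotone γ)
    (hO : (fun t => (γ t : ℝ)) =O[𝓝[>] (0 : ℝ≥0)] (fun t => (t : ℝ) ^ 2))
    [SFinite μ] [SFinite ν] (hf : IsPoissonMeasure f a μ) (hh : IsPoissonMeasure h b ν)
    {C C' : ℝ≥0} (hC : 0 < C) {δ ρ K : ℝ} (hδ : 0 < δ) (hρ : 0 < ρ) (hK : 0 ≤ K)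
    (hfin : ∫⁻ t in Metric.ball τ δ, (γ (C * nndist t τ) : ℝ≥0∞)⁻¹ ∂μ < ∞)
    (him : ∀ x y : ℝ, |x - τ| < ρ → 0 < y → y < ρ → (γ (C' * nndist x τ) : ℝ) ≤ y →
      (h (x + y * Complex.I)).im ≤ K * (f (x + y * Complex.I)).im) :
    ∃ D : ℝ≥0, 0 < D ∧ ∃ B : ℝ≥0, ∃ r₀ > 0, ∀ r : ℝ, 0 < r → r < r₀ →
      ∫⁻ t in shell τ r (2 * r), (γ (D * nndist t τ) : ℝ≥0∞)⁻¹ ∂ν ≤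
        B * (∫⁻ t in shell τ (r / 4) (4 * r), (γ (C * nndist t τ) : ℝ≥0∞)⁻¹ ∂μ +
          ENNReal.ofReal r) := by
  obtain ⟨-, M, hM, δ₁, hδ₁, hγ⟩ := exists_le_mul_sq_of_isBigO hmono hO
  have hA := lintegral_inv_sq_lt_top_of_regular hmono hO hf.2.1 hC hδ hfin
  obtain ⟨B, hB⟩ := hf.measure_shell_le hh hA hK
  -- The term `4 * C` covers the outer radius of the enlarged shell in the Chebyshev bound for `μ`;
  -- `3 * C'` makes height `γ(Dr)` admissible for all `|x - τ| ≤ 3r`.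
  set D : ℝ≥0 := 4 * C + 3 * C' with hD
  have hD0 : 0 < D := by positivity
  refine ⟨D, hD0, B, min (min (δ / 4) (ρ / 3)) (min (δ₁ / D) (1 / (4 * (M * D ^ 2)))),
    by positivity, fun r hr0 hr => ?_⟩
  lift r to ℝ≥0 using hr0.le
  have hr0' : 0 < r := by exact_mod_cast hr0
  have hr1 : (r : ℝ) < δ / 4 := hr.trans_le ((min_le_left _ _).trans (min_le_left _ _))
  have hr2 : (r : ℝ) < ρ / 3 := hr.trans_le ((min_le_left _ _).trans (min_le_right _ _))
  have hr3 : (r : ℝ) < δ₁ / D := hr.trans_le ((min_le_right _ _).trans (min_le_left _ _))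
  have hr4 : (r : ℝ) < 1 / (4 * (M * D ^ 2)) :=
    hr.trans_le ((min_le_right _ _).trans (min_le_right _ _))
  rw [lt_div_iff₀ (by positivity)] at hr3 hr4
  set G : ℝ≥0 := γ (D * r) with hG
  have hGr : (G : ℝ) < r / 2 := by
    have h1 : G ≤ M * (D * r) ^ 2 := hγ _ (by
      rw [← NNReal.coe_lt_coe, NNReal.coe_mul]; linarith)
    have h2 : (G : ℝ) ≤ M * (D * r) ^ 2 := by exact_mod_cast h1
    nlinarith
  set m := μ (shell τ (r / 4) (4 * r)) with hm
  set I := ∫⁻ t in shell τ (r / 4) (4 * r), (γ (C * nndist t τ) : ℝ≥0∞)⁻¹ ∂μ with hI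
  have hmI : m ≤ G * I := by
    refine (measure_le_mul_lintegral_inv_gauge hmono hfin (shell_subset_ball (by linarith))
      (measurableSet_shell _ _ _) (R := 4 * r) (fun t ht => ?_)).trans ?_
    · rw [← NNReal.coe_le_coe, coe_nndist, Real.dist_eq]
      exact ht.2
    · gcongr
      refine hmono ?_
      rw [hD, ← mul_assoc, mul_comm C 4]
      exact mul_le_mul_left le_self_add r
  have hνy : ∀ y : ℝ, (G : ℝ) < y → y < r / 2 →
      ν (shell τ r (2 * r)) ≤ B * (m + ENNReal.ofReal (r * y)) := fun y hy1 hy2 => by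
    have hy0 : 0 < y := lt_of_le_of_lt G.2 hy1
    refine hB r y hy0 hy2.le fun x hx => him x y (by linarith) hy0 (by linarith) ?_
    refine le_trans ?_ hy1.le
    rw [NNReal.coe_le_coe]
    refine hmono ?_
    have h1 : nndist x τ ≤ 3 * r := by
      rw [← NNReal.coe_le_coe, coe_nndist, Real.dist_eq]
      exact_mod_cast hx
    calc C' * nndist x τ ≤ C' * (3 * r) := by gcongr
      _ ≤ D * r := by
        rw [hD, ← mul_assoc, mul_comm C' 3]
        exact mul_le_mul_left le_add_self r
  -- The height `G` may be zero, so it is reached only as a limit of positive heights.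
  have hν : ν (shell τ r (2 * r)) ≤ B * (m + ENNReal.ofReal (r * G)) := by
    have hc : Tendsto (fun y : ℝ => (B : ℝ≥0∞) * (m + ENNReal.ofReal (r * y))) (𝓝[>] (G : ℝ))
        (𝓝 (B * (m + ENNReal.ofReal (r * G)))) := by
      refine Tendsto.mono_left ?_ nhdsWithin_le_nhds
      refine ENNReal.Tendsto.const_mul (Tendsto.const_add _ ?_) (Or.inr ENNReal.coe_ne_top)
      exact (ENNReal.continuous_ofReal.comp (by fun_prop)).tendsto _
    refine ge_of_tendsto hc ?_
    filter_upwards [Ioo_mem_nhdsGT hGr] with y hy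
    exact hνy y hy.1 hy.2
  have hν' : ν (shell τ r (2 * r)) ≤ G * (B * (I + ENNReal.ofReal r)) := by
    refine hν.trans ?_
    rw [ENNReal.ofReal_mul hr0.le, ENNReal.ofReal_coe_nnreal (p := G)]
    calc (B : ℝ≥0∞) * (m + ENNReal.ofReal r * G) ≤ B * (G * I + ENNReal.ofReal r * G) := by gcongr
      _ = _ := by ring
  -- If the gauge vanishes, the shell is `ν`-null and the infinite integrand does no harm; otherwise
  -- `G` cancels.
  rcases eq_or_ne G 0 with h0 | h0
  · rw [h0, ENNReal.coe_zero, zero_mul, nonpos_iff_eq_zero] at hν'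
    rw [setLIntegral_measure_zero _ _ hν']
    exact zero_le
  · calc ∫⁻ t in shell τ r (2 * r), (γ (D * nndist t τ) : ℝ≥0∞)⁻¹ ∂ν
        ≤ ∫⁻ t in shell τ r (2 * r), (G : ℝ≥0∞)⁻¹ ∂ν := by
          refine setLIntegral_mono' (measurableSet_shell _ _ _) fun t ht => ?_
          gcongr
          refine hmono ?_
          gcongr
          rw [← NNReal.coe_le_coe, coe_nndist, Real.dist_eq]
          exact ht.1.le
      _ = (G : ℝ≥0∞)⁻¹ * ν (shell τ r (2 * r)) := setLIntegral_const _ _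
      _ ≤ (G : ℝ≥0∞)⁻¹ * (G * (B * (I + ENNReal.ofReal r))) := by gcongr
      _ = _ := by
          rw [← mul_assoc, ENNReal.inv_mul_cancel (by simpa using h0) ENNReal.coe_ne_top, one_mul]

theorem tsum_ofReal_div_two_pow_lt_top (d : ℝ) :
    ∑' k : ℕ, ENNReal.ofReal (d / 2 ^ k) < ∞ := by
  have h : Summable fun k : ℕ => d / 2 ^ k := by
    simpa [div_eq_mul_inv] using (summable_geometric_two.mul_left d)
  exact h.tsum_ofReal_lt_top

/-- Each enlarged shell is covered by four consecutive dyadic ones, so every dyadic shell is counted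
at most four times. -/
theorem tsum_setLIntegral_shell_le (g : ℝ → ℝ≥0∞) (d : ℝ) :
    ∑' k : ℕ, ∫⁻ t in shell τ (d / 2 ^ k / 4) (4 * (d / 2 ^ k)), g t ∂μ ≤
      4 * ∫⁻ t in ⋃ k : ℕ, shell τ (2 * d / 2 ^ k) (4 * d / 2 ^ k), g t ∂μ := by
  set S : ℕ → Set ℝ := fun k => shell τ (2 * d / 2 ^ k) (4 * d / 2 ^ k) with hS
  have h1 : ∀ k : ℕ, ∫⁻ t in shell τ (d / 2 ^ k / 4) (4 * (d / 2 ^ k)), g t ∂μ ≤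
      ∑ i : Fin 4, ∫⁻ t in S (k + i), g t ∂μ := fun k => by
    refine (lintegral_mono_set (shell_subset_iUnion τ (d / 2 ^ k))).trans ?_
    refine (lintegral_iUnion_le _ _).trans ?_
    rw [tsum_fintype]
    refine Finset.sum_le_sum fun i _ => le_of_eq ?_
    simp only [hS, pow_add]
    congr 3 <;> ring
  have hdisj : Pairwise (Function.onFun Disjoint S) := by
    have := pairwise_disjoint_dyadic_shell τ (2 * d)
    rwa [show 2 * (2 * d) = 4 * d by ring] at this
  calc ∑' k : ℕ, ∫⁻ t in shell τ (d / 2 ^ k / 4) (4 * (d / 2 ^ k)), g t ∂μ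
      ≤ ∑' k : ℕ, ∑ i : Fin 4, ∫⁻ t in S (k + i), g t ∂μ := ENNReal.tsum_le_tsum h1
    _ = ∑ i : Fin 4, ∑' k : ℕ, ∫⁻ t in S (k + i), g t ∂μ :=
        Summable.tsum_finsetSum fun _ _ => ENNReal.summable
    _ ≤ ∑ i : Fin 4, ∑' k : ℕ, ∫⁻ t in S k, g t ∂μ :=
        Finset.sum_le_sum fun i _ =>
          ENNReal.tsum_comp_le_tsum_of_injective (add_left_injective (i : ℕ)) _
    _ = _ := by
        rw [lintegral_iUnion (fun k => measurableSet_shell _ _ _) hdisj]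
        simp [hS]

theorem exists_regular_of_im_le (hmono : Monotone γ)
    (hO : (fun t => (γ t : ℝ)) =O[𝓝[>] (0 : ℝ≥0)] (fun t => (t : ℝ) ^ 2))
    [SFinite μ] [SFinite ν] (hf : IsPoissonMeasure f a μ) (hh : IsPoissonMeasure h b ν)
    {C C' : ℝ≥0} (hC : 0 < C) {δ ρ K : ℝ} (hδ : 0 < δ) (hρ : 0 < ρ) (hK : 0 ≤ K)
    (hfin : ∫⁻ t in Metric.ball τ δ, (γ (C * nndist t τ) : ℝ≥0∞)⁻¹ ∂μ < ∞)
    (him : ∀ x y : ℝ, |x - τ| < ρ → 0 < y → y < ρ → (γ (C' * nndist x τ) : ℝ) ≤ y →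
      (h (x + y * Complex.I)).im ≤ K * (f (x + y * Complex.I)).im) :
    ∃ D : ℝ≥0, 0 < D ∧ ∃ N ∈ 𝓝 τ,
      ∫⁻ t in N, (γ (D * nndist t τ) : ℝ≥0∞)⁻¹ ∂ν < ∞ := by
  obtain ⟨h0, -⟩ := exists_le_mul_sq_of_isBigO hmono hO
  have hA := lintegral_inv_sq_lt_top_of_regular hmono hO hf.2.1 hC hδ hfin
  have hτ : ν {τ} = 0 := hf.measure_singleton_eq_zero hh hA hK hρ fun y hy hyρ =>
    him τ y (by simpa using hρ) hy hyρ (by simpa [h0] using hy.le)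
  obtain ⟨D, hD, B, r₀, hr₀, hb⟩ :=
    exists_setLIntegral_shell_inv_gauge_le hmono hO hf hh hC hδ hρ hK hfin him
  set d := min (r₀ / 2) (δ / 8) with hd
  have hd0 : 0 < d := by positivity
  have hdr : d < r₀ := (min_le_left _ _).trans_lt (by linarith)
  have hdδ : d ≤ δ / 8 := min_le_right _ _
  have hdk : ∀ k : ℕ, d / 2 ^ k ≤ d := fun k => div_le_self hd0.le (one_le_pow₀ (by norm_num))
  refine ⟨D, hD, Metric.ball τ d, Metric.ball_mem_nhds τ hd0, ?_⟩
  have hsum := tsum_setLIntegral_shell_le (τ := τ) (μ := μ)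
    (fun t => (γ (C * nndist t τ) : ℝ≥0∞)⁻¹) d
  have hsub : (⋃ k : ℕ, shell τ (2 * d / 2 ^ k) (4 * d / 2 ^ k)) ⊆ Metric.ball τ δ :=
    iUnion_subset fun k => shell_subset_ball (by
      have := hdk k
      rw [mul_div_assoc]; linarith)
  calc ∫⁻ t in Metric.ball τ d, (γ (D * nndist t τ) : ℝ≥0∞)⁻¹ ∂ν
      ≤ ∫⁻ t in {τ} ∪ ⋃ k : ℕ, shell τ (d / 2 ^ k) (2 * d / 2 ^ k),
          (γ (D * nndist t τ) : ℝ≥0∞)⁻¹ ∂ν := lintegral_mono_set (ball_subset_iUnion_shell hd0)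
    _ ≤ ∫⁻ t in {τ}, (γ (D * nndist t τ) : ℝ≥0∞)⁻¹ ∂ν +
          ∫⁻ t in ⋃ k : ℕ, shell τ (d / 2 ^ k) (2 * d / 2 ^ k),
          (γ (D * nndist t τ) : ℝ≥0∞)⁻¹ ∂ν := lintegral_union_le _ _ _
    _ ≤ 0 + ∑' k : ℕ, ∫⁻ t in shell τ (d / 2 ^ k) (2 * d / 2 ^ k),
          (γ (D * nndist t τ) : ℝ≥0∞)⁻¹ ∂ν :=
        add_le_add (setLIntegral_measure_zero _ _ hτ).le (lintegral_iUnion_le _ _)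
    _ ≤ ∑' k : ℕ, B * (∫⁻ t in shell τ (d / 2 ^ k / 4) (4 * (d / 2 ^ k)),
          (γ (C * nndist t τ) : ℝ≥0∞)⁻¹ ∂μ + ENNReal.ofReal (d / 2 ^ k)) := by
        rw [zero_add]
        refine ENNReal.tsum_le_tsum fun k => ?_
        rw [mul_div_assoc]
        exact hb _ (by positivity) ((hdk k).trans_lt hdr)
    _ = B * (∑' k : ℕ, ∫⁻ t in shell τ (d / 2 ^ k / 4) (4 * (d / 2 ^ k)),
          (γ (C * nndist t τ) : ℝ≥0∞)⁻¹ ∂μ + ∑' k : ℕ, ENNReal.ofReal (d / 2 ^ k)) := by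
        rw [ENNReal.tsum_mul_left, ENNReal.tsum_add]
    _ < ∞ := by
        refine ENNReal.mul_lt_top ENNReal.coe_lt_top (ENNReal.add_lt_top.2 ⟨hsum.trans_lt ?_,
          tsum_ofReal_div_two_pow_lt_top d⟩)
        exact ENNReal.mul_lt_top (by norm_num) ((lintegral_mono_set hsub).trans_lt hfin)

end GaugeTransfer

/-! ### Imaginary part of the outer function -/

theorem IsPick.mapsTo_or_eq_real {f : ℂ → ℂ} (hf : IsPick f) :
    MapsTo f upperHalf upperHalf ∨ ∃ c : ℝ, ∀ z ∈ upperHalf, f z = c := by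
  have hconv : IsPreconnected upperHalf := (convex_halfSpace_im_gt 0).isPreconnected
  have hopen : IsOpen upperHalf := isOpen_lt continuous_const Complex.continuous_im
  rcases hf.1.is_constant_or_isOpen hconv with ⟨c, hc⟩ | h
  · have hI : Complex.I ∈ upperHalf := by simp [upperHalf]
    have h0 : 0 ≤ c.im := by
      have := hf.2 hI
      rwa [hc _ hI] at this
    rcases h0.lt_or_eq with h1 | h1
    · refine Or.inl fun z hz => ?_
      rw [hc z hz]
      exact h1
    · exact Or.inr ⟨c.re, fun z hz => by rw [hc z hz]; apply Complex.ext <;> simp [← h1]⟩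
  · refine Or.inl fun z hz => ?_
    have h1 : f '' upperHalf ⊆ interior {z : ℂ | 0 ≤ z.im} :=
      interior_maximal (image_subset_iff.2 hf.2) (h _ subset_rfl hopen)
    rw [Complex.interior_setOfPred_le_im] at h1
    exact h1 (mem_image_of_mem f hz)

/-- An analytic function is locally Lipschitz; `ζ` is compared with `Re ζ`, where `g` is real. -/
theorem exists_im_le_mul_im {g : ℂ → ℂ} {p : ℝ} {U : Set ℂ} (hU : U ∈ 𝓝 (p : ℂ))
    (hg : AnalyticAt ℂ g p) (hreal : ∀ x : ℝ, (x : ℂ) ∈ U → (g x).im = 0) :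
    ∃ L : ℝ≥0, ∃ ρ > 0, ∀ ζ : ℂ, ‖ζ - p‖ < ρ → 0 ≤ ζ.im → (g ζ).im ≤ L * ζ.im := by
  obtain ⟨L, s, hs, hL⟩ := (hg.contDiffAt (n := 1)).exists_lipschitzOnWith
  obtain ⟨ρ, hρ, hb⟩ := Metric.mem_nhds_iff.1 (inter_mem hU hs)
  refine ⟨L, ρ, hρ, fun ζ hζ h0 => ?_⟩
  have h1 : (ζ.re : ℂ) ∈ Metric.ball (p : ℂ) ρ := by
    rw [mem_ball_iff_norm, ← Complex.ofReal_sub, Complex.norm_real]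
    refine lt_of_le_of_lt ?_ hζ
    simpa using Complex.abs_re_le_norm (ζ - p)
  have h2 := hL.norm_sub_le (hb (mem_ball_iff_norm.2 hζ)).2 (hb h1).2
  have h3 : ζ - (ζ.re : ℂ) = ζ.im * Complex.I := by
    apply Complex.ext <;> simp
  rw [h3, norm_mul, Complex.norm_I, mul_one, Complex.norm_real, Real.norm_of_nonneg h0] at h2
  have h4 := (le_abs_self _).trans (Complex.abs_im_le_norm (g ζ - g ζ.re))
  rw [Complex.sub_im, hreal _ (hb h1).1, sub_zero] at h4
  exact h4.trans h2

/-- For `ζ` in a bounded box the kernel divided by `Im ζ` has a positive lower bound depending only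
on `t`. Its integral plus `a` is positive, since otherwise `a` and `μ` would vanish, and so would
`Im g`. -/
theorem IsPoissonMeasure.exists_mul_im_le {g : ℂ → ℂ} {a : ℝ} {μ : Measure ℝ}
    (hP : IsPoissonMeasure g a μ) (hm : MapsTo g upperHalf upperHalf) (R : ℝ) :
    ∃ k : ℝ, 0 < k ∧ ∀ ζ : ℂ, |ζ.re| ≤ R → 0 < ζ.im → ζ.im ≤ R → k * ζ.im ≤ (g ζ).im := by
  have ha := hP.1
  set q : ℝ → ℝ := fun t => ((|t| + R) ^ 2 + R ^ 2)⁻¹ with hq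
  by_cases hR : 0 < R
  swap
  · exact ⟨1, one_pos, fun ζ _ h1 h2 => absurd (h1.trans_le h2) hR⟩
  have hq0 : ∀ t, 0 < q t := fun t => by positivity
  set I := ENNReal.ofReal a + ∫⁻ t, ENNReal.ofReal (q t) ∂μ with hI
  have hIpos : I ≠ 0 := fun h => by
    rw [hI, add_eq_zero] at h
    have hqm : Measurable fun t => ENNReal.ofReal (q t) := by fun_prop
    have h1 := (lintegral_eq_zero_iff hqm).1 h.2
    have h2 : ∀ᵐ t ∂μ, False := h1.mono fun t ht => by
      have := ENNReal.ofReal_eq_zero.1 ht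
      exact absurd (hq0 t) (not_lt.2 this)
    have h3 : μ = 0 := by simpa using h2
    have h4 := hP.2.2 0 1 one_pos
    have h5 : a = 0 := le_antisymm (ENNReal.ofReal_eq_zero.1 h.1) ha
    rw [h3, h5] at h4
    simp only [zero_mul, ENNReal.ofReal_zero, lintegral_zero_measure, add_zero] at h4
    have h6 := ENNReal.ofReal_eq_zero.1 h4
    have h7 : 0 < (g ((0 : ℝ) + (1 : ℝ) * Complex.I)).im := hm (by simp [upperHalf])
    nlinarith [Real.pi_pos]
  -- Truncating at 1 makes the constant finite without further argument.
  set c := (min 1 I).toReal with hc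
  have hmin : min 1 I ≠ ∞ := ((min_le_left _ _).trans_lt ENNReal.one_lt_top).ne
  have hc0 : 0 < c := ENNReal.toReal_pos (lt_min one_pos (pos_iff_ne_zero.2 hIpos)).ne' hmin
  refine ⟨c / Real.pi, by positivity, fun ζ h1 h2 h3 => ?_⟩
  have h4 := hP.2.2 ζ.re ζ.im h2
  rw [Complex.re_add_im] at h4
  have h5 : ENNReal.ofReal ζ.im * I ≤ ENNReal.ofReal (Real.pi * (g ζ).im) := by
    rw [h4, hI, mul_add, ← ENNReal.ofReal_mul h2.le, mul_comm ζ.im a,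
      ← lintegral_const_mul' _ _ ENNReal.ofReal_ne_top]
    gcongr with t
    rw [← ENNReal.ofReal_mul h2.le]
    refine ENNReal.ofReal_le_ofReal ?_
    rw [halfPlaneKernel, hq, ← div_eq_mul_inv]
    have h6 : |t - ζ.re| ≤ |t| + R := (abs_sub _ _).trans (by gcongr)
    have h7 : (t - ζ.re) ^ 2 ≤ (|t| + R) ^ 2 := by
      rw [← sq_abs (t - ζ.re)]; gcongr
    gcongr
  have h6 : ENNReal.ofReal (ζ.im * c) ≤ ENNReal.ofReal (Real.pi * (g ζ).im) := by
    refine le_trans ?_ h5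
    rw [ENNReal.ofReal_mul h2.le, hc, ENNReal.ofReal_toReal hmin]
    gcongr
    exact min_le_right _ _
  have h7 : 0 < (g ζ).im := hm h2
  rw [ENNReal.ofReal_le_ofReal_iff (by positivity)] at h6
  rw [div_mul_eq_mul_div, div_le_iff₀ Real.pi_pos]
  linarith

/-! ### Consequences of regularity and degenerate cases -/

section Regularity

variable {γ : ℝ≥0 → ℝ≥0} {f : ℂ → ℂ} {τ : ℝ}

theorem IsRegularAt.exists_isPoissonMeasure (hf : IsPick f) (hr : IsRegularAt γ f τ) :
    ∃ (a : ℝ) (μ : Measure ℝ) (C : ℝ≥0) (δ : ℝ), IsLocallyFiniteMeasure μ ∧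
      IsPoissonMeasure f a μ ∧ 0 < C ∧ 0 < δ ∧
        ∫⁻ t in Metric.ball τ δ, (γ (C * nndist t τ) : ℝ≥0∞)⁻¹ ∂μ < ∞ := by
  obtain ⟨μ, hμ, C, hC, N, hN, hfin⟩ := hr
  obtain ⟨ν, hν, a, hP⟩ := hf.exists_isNevanlinnaMeasure
  obtain rfl := hμ.unique hν
  obtain ⟨δ, hδ, hb⟩ := Metric.mem_nhds_iff.1 hN
  exact ⟨a, μ, C, δ, hμ.1, hP, hC, hδ, (lintegral_mono_set hb).trans_lt hfin⟩

/-- Vertically above `τ` the imaginary part is `O(y)`, so the limit is real. -/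
theorem IsRegularAt.im_eq_zero (hmono : Monotone γ)
    (hO : (fun t => (γ t : ℝ)) =O[𝓝[>] (0 : ℝ≥0)] (fun t => (t : ℝ) ^ 2))
    (hf : IsPick f) {w : ℂ} (hw : HasNontangentialLimit f τ w) (hr : IsRegularAt γ f τ) :
    w.im = 0 := by
  obtain ⟨a, μ, C, δ, hμ, hP, hC, hδ, hfin⟩ := hr.exists_isPoissonMeasure hf
  obtain ⟨K, hK, hb⟩ := hP.exists_im_le
    (lintegral_inv_sq_lt_top_of_regular hmono hO hP.2.1 hC hδ hfin)
  by_contra hne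
  obtain ⟨ρ, hρ, h1⟩ := hw.exists_forall_norm_sub_lt (half_pos (abs_pos.2 hne))
  have hlim : Tendsto (fun y : ℝ => K * y) (𝓝[>] 0) (𝓝 0) := by
    have : Continuous fun y : ℝ => K * y := by fun_prop
    simpa using (this.tendsto 0).mono_left nhdsWithin_le_nhds
  obtain ⟨y, hy1, hy2⟩ := ((hlim.eventually (gt_mem_nhds (half_pos (abs_pos.2 hne)))).and
    (Ioo_mem_nhdsGT hρ)).exists
  have h2 := h1 τ y (by simpa using hy2.1.le) hy2.1 hy2.2
  have h3 := hb τ y hy2.1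
  simp only [sub_self, abs_zero, zero_div, Metric.ball_zero, measure_empty, mul_zero,
    add_zero] at h3
  rw [ENNReal.ofReal_le_ofReal_iff (mul_nonneg hK hy2.1.le)] at h3
  have h4 : 0 ≤ (f (τ + y * Complex.I)).im := hf.2 (by simpa [upperHalf] using hy2.1)
  have h5 : (f (τ + y * Complex.I)).im ≤ K * y := by nlinarith [Real.pi_gt_three]
  have h6 := (Complex.abs_im_le_norm _).trans_lt h2
  rw [Complex.sub_im] at h6
  have h7 := abs_sub_abs_le_abs_sub w.im (f (τ + y * Complex.I)).im
  rw [abs_sub_comm, abs_of_nonneg h4] at h7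
  linarith

theorem isRegularAt_of_eq_real (γ : ℝ≥0 → ℝ≥0) (τ : ℝ)
    (h : ∀ z ∈ upperHalf, (f z).im = 0) : IsRegularAt γ f τ := by
  refine ⟨0, ⟨inferInstance, fun φ _ _ => ?_⟩, 1, one_pos, univ, univ_mem, by simp⟩
  rw [integral_zero_measure]
  refine tendsto_const_nhds.congr' ?_
  filter_upwards [self_mem_nhdsWithin] with y hy
  have h1 : ∀ x : ℝ, (f (x + y * Complex.I)).im = 0 := fun x =>
    h _ (by simpa [upperHalf] using mem_Ioi.1 hy)
  simp [h1]

instance stolzRegion_neBot (τ : ℝ) : (𝓝[stolzRegion τ 1] (τ : ℂ)).NeBot := by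
  rw [← mem_closure_iff_nhdsWithin_neBot, Metric.mem_closure_iff]
  intro ε hε
  refine ⟨τ + (ε / 2 : ℝ) * Complex.I, ⟨?_, ?_⟩, ?_⟩
  · simpa [upperHalf] using hε
  · simp [dist_eq_norm, abs_of_pos hε]
  · simp [dist_eq_norm, abs_of_pos hε]
    linarith

theorem HasNontangentialLimit.im_nonneg (hf : IsPick f) {w : ℂ}
    (hw : HasNontangentialLimit f τ w) : 0 ≤ w.im := by
  refine ge_of_tendsto ((Complex.continuous_im.tendsto w).comp (hw 1 one_pos)) ?_
  filter_upwards [self_mem_nhdsWithin] with z hz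
  exact hf.2 hz.1

theorem HasNontangentialLimit.eq_of_const {c w : ℂ} (h : ∀ z ∈ upperHalf, f z = c)
    (hw : HasNontangentialLimit f τ w) : w = c := by
  refine tendsto_nhds_unique (hw 1 one_pos) (tendsto_const_nhds.congr' ?_)
  filter_upwards [self_mem_nhdsWithin] with z hz
  exact (h z hz.1).symm

theorem isRegularAt_of_im_le (hmono : Monotone γ)
    (hO : (fun t => (γ t : ℝ)) =O[𝓝[>] (0 : ℝ≥0)] (fun t => (t : ℝ) ^ 2))
    {h : ℂ → ℂ} (hh : IsPick h) {a : ℝ} {μ : Measure ℝ} [IsLocallyFiniteMeasure μ]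
    (hP : IsPoissonMeasure f a μ) {C C' : ℝ≥0} (hC : 0 < C) {δ ρ K : ℝ} (hδ : 0 < δ) (hρ : 0 < ρ)
    (hK : 0 ≤ K) (hfin : ∫⁻ t in Metric.ball τ δ, (γ (C * nndist t τ) : ℝ≥0∞)⁻¹ ∂μ < ∞)
    (him : ∀ x y : ℝ, |x - τ| < ρ → 0 < y → y < ρ → (γ (C' * nndist x τ) : ℝ) ≤ y →
      (h (x + y * Complex.I)).im ≤ K * (f (x + y * Complex.I)).im) :
    IsRegularAt γ h τ := by
  obtain ⟨ν, hν, b, hQ⟩ := hh.exists_isNevanlinnaMeasure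
  have := hν.1
  exact ⟨ν, hν, exists_regular_of_im_le hmono hO hP hQ hC hδ hρ hK hfin him⟩

end Regularity

/-! ### Pulling convergence back through the outer function -/

theorem exists_sphere_forall_le_norm_sub {g : ℂ → ℂ} {w : ℂ} (hg : ∀ᶠ ζ in 𝓝 w, AnalyticAt ℂ g ζ)
    (hne : ∃ᶠ ζ in 𝓝 w, g ζ ≠ g w) {r : ℝ} (hr : 0 < r) :
    ∃ ρ, 0 < ρ ∧ ρ < r ∧ ∃ ε > 0, ∀ ζ, ‖ζ - w‖ = ρ → ε ≤ ‖g ζ - g w‖ := by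
  have hA : AnalyticAt ℂ g w := hg.self_of_nhds
  have h1 : ∀ᶠ ζ in 𝓝[≠] w, g ζ ≠ g w := by
    rcases (hA.sub (analyticAt_const : AnalyticAt ℂ (fun _ => g w) w)).eventually_eq_zero_or_eventually_ne_zero with h | h
    · exact absurd (h.mono fun ζ hζ => not_not.2 (sub_eq_zero.1 hζ)) hne
    · exact h.mono fun ζ hζ => sub_ne_zero.1 hζ
  obtain ⟨d, hd, hb⟩ := Metric.mem_nhds_iff.1 (inter_mem hg (eventually_nhdsWithin_iff.1 h1))
  set ρ := min (d / 2) (r / 2) with hρ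
  have hρ0 : 0 < ρ := by positivity
  have hρd : ρ < d := (min_le_left _ _).trans_lt (by linarith)
  have hsub : ∀ ζ ∈ Metric.sphere w ρ, ζ ∈ Metric.ball w d := fun ζ hζ => by
    rw [Metric.mem_ball, Metric.mem_sphere.1 hζ]; exact hρd
  have hcont : ContinuousOn (fun ζ => ‖g ζ - g w‖) (Metric.sphere w ρ) := fun ζ hζ =>
    (((hb (hsub ζ hζ)).1.continuousAt.sub continuousAt_const).norm).continuousWithinAt
  obtain ⟨ζ₀, hζ₀, hmin⟩ := (isCompact_sphere w ρ).exists_isMinOn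
    (NormedSpace.sphere_nonempty.2 hρ0.le) hcont
  refine ⟨ρ, hρ0, (min_le_right _ _).trans_lt (by linarith), ‖g ζ₀ - g w‖, ?_, fun ζ hζ =>
    hmin (mem_sphere_iff_norm.2 hζ)⟩
  refine norm_pos_iff.2 (sub_ne_zero.2 ((hb (hsub ζ₀ hζ₀)).2 fun h => ?_))
  rw [mem_sphere_iff_norm, h] at hζ₀
  simp at hζ₀
  exact hρ0.ne hζ₀

/-- Descending vertically from the cone, where `f` is near `w`, the path stays in the region above
the gauge. To leave the disc of radius `r`, `f` would have to cross its circle, where `g` is too far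
from `g w`. -/
theorem HasNontangentialLimit.exists_forall_norm_sub_lt_of_comp {γ : ℝ≥0 → ℝ≥0} {f g : ℂ → ℂ}
    {τ : ℝ} {w : ℂ} (hf : AnalyticOnNhd ℂ f upperHalf) (hw : HasNontangentialLimit f τ w)
    {C : ℝ≥0} {r ε ρ : ℝ} (hr : 0 < r) (hρ : 0 < ρ)
    (hsphere : ∀ ζ, ‖ζ - w‖ = r → ε ≤ ‖g ζ - g w‖)
    (hcomp : ∀ x y : ℝ, |x - τ| < ρ → 0 < y → y < ρ → (γ (C * nndist x τ) : ℝ) ≤ y →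
      ‖g (f (x + y * Complex.I)) - g w‖ < ε) :
    ∃ ρ' > 0, ∀ x y : ℝ, |x - τ| < ρ' → 0 < y → y < ρ' → (γ (C * nndist x τ) : ℝ) ≤ y →
      ‖f (x + y * Complex.I) - w‖ < r := by
  obtain ⟨ρ₁, hρ₁, hnt⟩ := hw.exists_forall_norm_sub_lt hr
  refine ⟨min ρ ρ₁, lt_min hρ hρ₁, fun x y hx hy hyρ hγ => ?_⟩
  rcases le_or_gt |x - τ| y with hxy | hxy
  · exact hnt x y hxy hy (hyρ.trans_le (min_le_right _ _))
  have h1 := hnt x |x - τ| le_rfl (hy.trans hxy) (hx.trans_le (min_le_right _ _))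
  by_contra! hcon
  have hcont : ContinuousOn (fun v : ℝ => ‖f (x + v * Complex.I) - w‖) (Icc y |x - τ|) := by
    refine ContinuousOn.norm (ContinuousOn.sub ?_ continuousOn_const)
    refine hf.continuousOn.comp (by fun_prop) fun v hv => ?_
    simpa [upperHalf] using hy.trans_le hv.1
  obtain ⟨v, hv, hvr⟩ := intermediate_value_Icc' hxy.le hcont ⟨h1.le, hcon⟩
  have h2 := hcomp x v (hx.trans_le (min_le_left _ _)) (hy.trans_le hv.1)
    (hv.2.trans_lt (hx.trans_le (min_le_left _ _))) (hγ.trans hv.1)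
  exact absurd (hsphere _ hvr) (not_le.2 h2)

/-! ### The equivalence -/

theorem isRegularAt_iff_comp {γ : ℝ≥0 → ℝ≥0} (hmono : Monotone γ)
    (hO : (fun t => (γ t : ℝ)) =O[𝓝[>] (0 : ℝ≥0)] (fun t => (t : ℝ) ^ 2))
    {f : ℂ → ℂ} (hf : IsPick f) {τ : ℝ} {w : ℂ} (hw : HasNontangentialLimit f τ w)
    {U : Set ℂ} {g : ℂ → ℂ} (hU : U ∈ 𝓝 w) (hg : AnalyticOnNhd ℂ g (upperHalf ∪ U))
    (hgm : MapsTo g upperHalf closedUpperHalf)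
    (hne : ∃ z₁ ∈ upperHalf, ∃ z₂ ∈ upperHalf, g z₁ ≠ g z₂)
    (hreal : ∀ x : ℝ, (x : ℂ) ∈ U → (g x).im = 0) :
    IsRegularAt γ f τ ↔ IsRegularAt γ (g ∘ f) τ := by
  have hgw : AnalyticAt ℂ g w := hg w (Or.inr (mem_of_mem_nhds hU))
  have hgP : IsPick g := ⟨hg.mono subset_union_left, hgm⟩
  have hgm' : MapsTo g upperHalf upperHalf := by
    refine hgP.mapsTo_or_eq_real.resolve_right ?_
    rintro ⟨c, hc⟩
    obtain ⟨z₁, h1, z₂, h2, h3⟩ := hne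
    exact h3 ((hc z₁ h1).trans (hc z₂ h2).symm)
  rcases hf.mapsTo_or_eq_real with hfm | ⟨c, hc⟩
  swap
  -- For a real constant `f`, its value is the limit `w ∈ U`, where `g` is real; both functions then
  -- have zero Nevanlinna measure.
  · have hwc := hw.eq_of_const hc
    have h1 : IsRegularAt γ f τ := isRegularAt_of_eq_real γ τ fun z hz => by simp [hc z hz]
    have h2 : IsRegularAt γ (g ∘ f) τ := isRegularAt_of_eq_real γ τ fun z hz => by
      rw [Function.comp_apply, hc z hz]
      exact hreal c (hwc ▸ mem_of_mem_nhds hU)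
    exact iff_of_true h1 h2
  have hhm : MapsTo (g ∘ f) upperHalf upperHalf := hgm'.comp hfm
  have hhP : IsPick (g ∘ f) :=
    ⟨hgP.1.comp hf.1 hfm, fun z hz => (show 0 < ((g ∘ f) z).im from hhm hz).le⟩
  have hhw : HasNontangentialLimit (g ∘ f) τ (g w) := fun M hM =>
    hgw.continuousAt.tendsto.comp (hw M hM)
  have hw0 := hw.im_nonneg hf
  constructor
  · intro hr
    have him := hr.im_eq_zero hmono hO hf hw
    obtain ⟨p, rfl⟩ : ∃ p : ℝ, w = p := ⟨w.re, by apply Complex.ext <;> simp [him]⟩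
    obtain ⟨a, μ, C, δ, hμ, hP, hC, hδ, hfin⟩ := hr.exists_isPoissonMeasure hf
    obtain ⟨L, ρ, hρ, hL⟩ := exists_im_le_mul_im hU hgw hreal
    obtain ⟨ρ', hρ', hb⟩ :=
      exists_forall_norm_sub_lt_of_regular hmono hO hf.1 hfm hP hC hδ hfin hw hρ
    exact isRegularAt_of_im_le hmono hO hhP hP hC hδ hρ' L.2 hfin fun x y hx hy hyρ hγ =>
      hL _ (hb x y hx hy hyρ hγ) (hf.2 (by simpa [upperHalf] using hy))
  · intro hr
    -- A limit inside the open half plane would give `g ∘ f` a nonreal limit, against its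
    -- regularity.
    have him : w.im = 0 := by
      refine (hw0.eq_or_lt.resolve_right fun h => ?_).symm
      have h1 : 0 < (g w).im := hgm' h
      exact h1.ne' (hr.im_eq_zero hmono hO hhP hhw)
    obtain ⟨p, rfl⟩ : ∃ p : ℝ, w = p := ⟨w.re, by apply Complex.ext <;> simp [him]⟩
    obtain ⟨a, μ, C, δ, hμ, hP, hC, hδ, hfin⟩ := hr.exists_isPoissonMeasure hhP
    obtain ⟨κ, -, b, hQ⟩ := hgP.exists_isNevanlinnaMeasure
    -- A box of this size contains the part of the unit disc about `p` in the upper half plane, to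
    -- which the barrier circle of radius below 1 confines `f`.
    obtain ⟨k, hk, hkb⟩ := hQ.exists_mul_im_le hgm' (|p| + 1)
    -- The value at `p` is real, while `g` is nonreal at upper half plane points arbitrarily close
    -- to `p`.
    have hfreq : ∃ᶠ ζ in 𝓝 (p : ℂ), g ζ ≠ g p := by
      have h1 : ∃ᶠ ζ in 𝓝 (p : ℂ), ζ ∈ upperHalf := by
        rw [← mem_closure_iff_frequently]
        show (p : ℂ) ∈ closure {z : ℂ | 0 < z.im}
        rw [Complex.closure_setOfPred_lt_im]
        simp
      refine h1.mono fun ζ hζ h2 => ?_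
      have h3 : 0 < (g ζ).im := hgm' hζ
      rw [h2, hreal p (mem_of_mem_nhds hU)] at h3
      exact lt_irrefl _ h3
    obtain ⟨r, hr0, hr1, ε, hε, hsph⟩ := exists_sphere_forall_le_norm_sub
      (eventually_of_mem hU fun ζ hζ => hg ζ (Or.inr hζ)) hfreq one_pos
    obtain ⟨ρ, hρ, hb⟩ :=
      exists_forall_norm_sub_lt_of_regular hmono hO hhP.1 hhm hP hC hδ hfin hhw hε
    obtain ⟨ρ', hρ', hb'⟩ := hw.exists_forall_norm_sub_lt_of_comp hf.1 hr0 hρ hsph hb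
    refine isRegularAt_of_im_le (C' := 2 * C) hmono hO hf hP hC hδ hρ' (inv_nonneg.2 hk.le) hfin
      fun x y hx hy hyρ hγ => ?_
    have h1 := (hb' x y hx hy hyρ hγ).trans hr1
    have h2 : 0 < (f (x + y * Complex.I)).im := hfm (by simpa [upperHalf] using hy)
    set ζ := f (x + y * Complex.I) with hζ
    have h3 := (Complex.abs_re_le_norm _).trans h1.le
    have h4 := (le_abs_self _).trans ((Complex.abs_im_le_norm _).trans h1.le)
    simp only [Complex.sub_re, Complex.ofReal_re, Complex.sub_im, Complex.ofReal_im,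
      sub_zero] at h3 h4
    have h5 : |ζ.re| ≤ |p| + 1 := by
      have := abs_sub_abs_le_abs_sub ζ.re p
      linarith
    have h6 := hkb ζ h5 h2 (h4.trans (by linarith [abs_nonneg p]))
    rw [Function.comp_apply, inv_mul_eq_div, le_div_iff₀ hk, mul_comm]
    exact h6

theorem im_div_one_add_mul (α : ℝ) (z : ℂ) :
    (z / (1 + α * z)).im = z.im / Complex.normSq (1 + α * z) := by
  rw [Complex.div_im, ← sub_div]
  congr 1
  simp
  ring

theorem one_add_mul_ne_zero (α : ℝ) {z : ℂ} (hz : z ∈ upperHalf) : 1 + (α : ℂ) * z ≠ 0 := by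
  intro h
  have hz' : 0 < z.im := hz
  have h1 := congrArg Complex.im h
  simp [hz'.ne'] at h1
  simp [h1] at h

theorem mainTheorem4
    (γ : ℝ≥0 → ℝ≥0) (hmono : Monotone γ)
    (hO : (fun t => (γ t : ℝ)) =O[𝓝[>] (0 : ℝ≥0)] (fun t => (t : ℝ) ^ 2))
    (haug : IsAugury γ hmono γ)
    (f : ℂ → ℂ) (hf : IsPick f)
    (τ : ℝ) (w : ℂ) (hw : HasNontangentialLimit f τ w) :
    (∀ (U : Set ℂ) (g : ℂ → ℂ), U ∈ 𝓝 w →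
      AnalyticOnNhd ℂ g (upperHalf ∪ U) →
      MapsTo g upperHalf closedUpperHalf →
      (∃ z₁ ∈ upperHalf, ∃ z₂ ∈ upperHalf, g z₁ ≠ g z₂) →
      (∀ x : ℝ, (x : ℂ) ∈ U → (g x).im = 0) →
      (IsRegularAt γ f τ ↔ IsRegularAt γ (g ∘ f) τ)) ∧
    (∀ α : ℝ, 1 + α * w ≠ 0 →
      (IsRegularAt γ f τ ↔ IsRegularAt γ (fun z => f z / (1 + α * f z)) τ)) := by
  refine ⟨fun U g hU hg hgm hne hreal =>
    isRegularAt_iff_comp hmono hO hf hw hU hg hgm hne hreal, fun α hα => ?_⟩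
  have hopen : IsOpen {z : ℂ | 1 + (α : ℂ) * z ≠ 0} := isOpen_ne_fun (by fun_prop) (by fun_prop)
  refine isRegularAt_iff_comp hmono hO hf hw (U := {z : ℂ | 1 + (α : ℂ) * z ≠ 0})
    (g := fun z => z / (1 + α * z)) (hopen.mem_nhds hα) ?_ ?_ ?_ ?_
  · rintro z (hz | hz)
    · exact analyticAt_id.div (by fun_prop) (one_add_mul_ne_zero α hz)
    · exact analyticAt_id.div (by fun_prop) hz
  · intro z hz
    have hz' : 0 < z.im := hz
    show 0 ≤ (z / (1 + α * z)).im
    rw [im_div_one_add_mul]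
    exact div_nonneg hz'.le (Complex.normSq_nonneg _)
  · have h1 : Complex.I ∈ upperHalf := by simp [upperHalf]
    have h2 : 2 * Complex.I ∈ upperHalf := by simp [upperHalf]
    refine ⟨_, h1, _, h2, fun h => ?_⟩
    rw [div_eq_div_iff (one_add_mul_ne_zero α h1) (one_add_mul_ne_zero α h2)] at h
    have h3 : Complex.I = 0 := by linear_combination -h
    exact Complex.I_ne_zero h3
  · intro x _
    show ((x : ℂ) / (1 + α * x)).im = 0
    rw [im_div_one_add_mul, Complex.ofReal_im, zero_div]
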